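/- **Definitions.** All graphs are finite and simple; the order of a path is its number of vertices; logarithms are in base 2. An *ordered graph* is a graph with a total order on its vertex set. A *star* is a graph $K_{1,r}$ with $r\ge 0$ (so a single vertex is a star); its *center* is the vertex of degree $r$ (either vertex if $r=1$). *Constellations* are the ordered graphs obtained inductively as follows: the empty graph is a constellation; if an ordered graph $H$ is the disjoint union of a star $S$ and a constellation (with the order induced by $H$), and the center of $S$ is the first or the last vertex of $H$, then $H$ is a constellation; and the concatenation of two constellations $A,B$ (their disjoint union, with all vertices of $A$ preceding all vertices of $B$) is a constellation. Let $P=v_1,\dots,v_n$ be a path in a graph $G$. The graph $G[P]-E(P)$ is ordered by $v_1\prec\dots\prec v_n$. For an ordered graph $H$, the pair $(G,P)$ *avoids $H$ as a pattern* if there is no order-preserving injection $V(H)\to\{v_1,\dots,v_n\}$ that maps edges of $H$ to edges of $G[P]-E(P)$. Let $g_H(n)$ be the maximum integer $m$ such that every graph $G$ with a path $P$ of order $n$ for which $(G,P)$ avoids $H$ as a pattern has an induced path of order at least $m$. *The graphs $G_\ell$.* For $\ell\ge 1$ let $h(\ell)=5\cdot 2^{\ell-1}-2$, and let $B_\ell$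 be the complete binary tree with $h(\ell)$ levels, whose root has depth $1$ and whose leaves have depth $h(\ell)$. Let $\mathcal N_1=\{(1,3)\}$ and, for $\ell\ge2$, $$\mathcal N_\ell=\{(1,h(\ell))\}\cup\{(i+1,j+1):(i,j)\in\mathcal N_{\ell-1}\}\cup\{(i+h(\ell-1)+1,\,j+h(\ell-1)+1):(i,j)\in\mathcal N_{\ell-1}\}.$$ The *gadget* has 16 vertices: for $x\in\{L,R\}$ an out-port $o_x$ and a vertex $b_x$, and for $x,y\in\{L,R\}$ two in-ports $p_{xy},q_{xy}$ and a connector $c_{xy}$. Its 17 edges are $o_xb_y$, $p_{xy}q_{xy}$ and $q_{xy}c_{xy}$ for all $x,y\in\{L,R\}$, $b_xp_{xx}$ and $c_{xL}c_{xR}$ for $x\in\{L,R\}$, and $p_{LR}p_{RL}$. The graph $G_\ell$ is obtained by taking a copy of the gadget for every node of $B_\ell$ (the copy of a vertex $v$ at the node $s$ is written $v(s)$) and adding the following edges: * for every non-leaf node $s$ with left child $s_L$ and right child $s_R$, the edges between $c_{xy}(s)$ and $o_y(s_x)$ for all $x,y\in\{L,R\}$; * for every node $s$ and every proper descendant $t$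 of $s$ such that the pair $(\mathrm{depth}(s),\mathrm{depth}(t))$ belongs to $\mathcal N_\ell$, the edges ("ribs") between $o_L(s)$ and $p_{xy}(t)$ and between $o_R(s)$ and $q_{xy}(t)$, for all $x,y\in\{L,R\}$. **Theorem.** 1. For every ordered graph $H$ that is not a constellation, the maximum $g_H(n)$ exists for every $n\ge0$, and $g_H(n)=O((\log\log n)^2)$ as $n\to\infty$. 2. There is a constant $C$ such that for every integer $\ell\ge1$: * $G_\ell$ has at least $2^{2^\ell}$ vertices; * $G_\ell$ is 2-degenerate, i.e. every nonempty subgraph of $G_\ell$ has a vertex of degree at most $2$; * every induced path of $G_\ell$ has order at most $C\ell^2$; * $G_\ell$ has a Hamiltonian path $P$ such that $G_\ell-E(P)$, ordered along $P$, is a constellation; moreover $(G_\ell,P)$ avoids as a pattern every ordered graph that is not a constellation. -/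

import Mathlib

namespace OrderedPattern

open SimpleGraph

/-! ## Ordered graphs, patterns and the function `g_H`

A finite ordered graph with `k` vertices is a `SimpleGraph (Fin k)`, ordered by the order of `Fin k`.
A path of order `n` in `G` is a (not necessarily induced) copy of `pathGraph n` in `G`, and an
induced path of order `n` is an induced copy of `pathGraph n`. -/

/-- The ordered graph `G` contains the ordered graph `H` as an ordered subgraph. -/
def ContainsOrdered {k n : ℕ} (G : SimpleGraph (Fin n)) (H : SimpleGraph (Fin k)) : Prop :=
  ∃ a : Fin k ↪o Fin n, ∀ i j, H.Adj i j → G.Adj (a i) (a j)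

/-- For a path `P = v_1, …, v_n` of `G`, the graph `G[P] - E(P)`, ordered along `P`. When `P` is
Hamiltonian this is `G - E(P)`. -/
def offPath {V : Type} {G : SimpleGraph V} {n : ℕ} (P : Copy (pathGraph n) G) :
    SimpleGraph (Fin n) :=
  G.comap P \ pathGraph n

/-- `(G, P)` avoids the pattern `H`. -/
def AvoidsPattern {V : Type} {G : SimpleGraph V} {n k : ℕ} (P : Copy (pathGraph n) G)
    (H : SimpleGraph (Fin k)) : Prop :=
  ¬ ContainsOrdered (offPath P) H

/-- The integers `m` such that every finite graph with a path of order `n` avoiding the pattern `H`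
has an induced path of order at least `m`. -/
def guaranteedOrders {k : ℕ} (H : SimpleGraph (Fin k)) (n : ℕ) : Set ℕ :=
  {m | ∀ (V : Type) [Finite V] (G : SimpleGraph V) (P : Copy (pathGraph n) G),
    AvoidsPattern P H → ∃ q, m ≤ q ∧ pathGraph q ⊴ G}

/-- `g_H(n)`: the maximum element of `guaranteedOrders H n`. -/
noncomputable def inducedPathFunction {k : ℕ} (H : SimpleGraph (Fin k)) (n : ℕ) : ℕ :=
  sSup (guaranteedOrders H n)

/-! ## Constellations -/

/-- The subgraph of `H` induced by `S` is a star with center `c`. A single vertex is a star without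
leaves; in a star with one leaf both vertices are centers. -/
def IsStarOn {V : Type} (H : SimpleGraph V) (c : V) (S : Set V) : Prop :=
  c ∈ S ∧ ∀ u ∈ S, ∀ v ∈ S, (H.Adj u v ↔ u ≠ v ∧ (u = c ∨ v = c))

/-- There is no edge of `H` between `A` and `B`. -/
def NoEdgesBetween {V : Type} (H : SimpleGraph V) (A B : Set V) : Prop :=
  ∀ u ∈ A, ∀ v ∈ B, ¬ H.Adj u v

/-- The ordered subgraph of `H` induced by a set of vertices is a constellation: a disjoint union of
stars which is empty, or in which the center of one of the stars is the first (or the last) vertex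
and the remaining stars form a constellation, or which is a concatenation of two constellations. -/
inductive IsConstellationOn {V : Type} [LinearOrder V] (H : SimpleGraph V) : Set V → Prop
  | empty : IsConstellationOn H ∅
  | first (c : V) (S T : Set V) (hST : Disjoint S T) (hS : IsStarOn H c S)
      (hsep : NoEdgesBetween H S T) (hc : ∀ v ∈ S ∪ T, c ≤ v) (hT : IsConstellationOn H T) :
      IsConstellationOn H (S ∪ T)
  | last (c : V) (S T : Set V) (hST : Disjoint S T) (hS : IsStarOn H c S)
      (hsep : NoEdgesBetween H S T) (hc : ∀ v ∈ S ∪ T, v ≤ c) (hT : IsConstellationOn H T) :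
      IsConstellationOn H (S ∪ T)
  | concat (A B : Set V) (hlt : ∀ a ∈ A, ∀ b ∈ B, a < b) (hsep : NoEdgesBetween H A B)
      (hA : IsConstellationOn H A) (hB : IsConstellationOn H B) :
      IsConstellationOn H (A ∪ B)

/-- The ordered graph `H` is a constellation. -/
def IsConstellation {k : ℕ} (H : SimpleGraph (Fin k)) : Prop :=
  IsConstellationOn H Set.univ

/-! ## Degeneracy -/

/-- `G` is `d`-degenerate: every nonempty finite (induced) subgraph has a vertex of degree at most
`d`. -/
def IsDegenerate {V : Type} (d : ℕ) (G : SimpleGraph V) : Prop :=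
  ∀ S : Finset V, S.Nonempty → ∃ v ∈ S, {w | w ∈ S ∧ G.Adj v w}.ncard ≤ d

/-! ## The graphs `G_ℓ` -/

/-- `h(ℓ) = 5 · 2^(ℓ-1) - 2` for `ℓ ≥ 1`. -/
def treeDepth (ℓ : ℕ) : ℕ := 5 * 2 ^ (ℓ - 1) - 2

/-- The translate of a set of pairs of integers by `i`. -/
def shift (X : Finset (ℕ × ℕ)) (i : ℕ) : Finset (ℕ × ℕ) :=
  X.image fun x => (x.1 + i, x.2 + i)

/-- The nested interval systems `N_ℓ`, for `ℓ ≥ 1`. -/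
def nestedIntervals : ℕ → Finset (ℕ × ℕ)
  | 0 => ∅
  | 1 => {(1, 3)}
  | ℓ + 2 => {(1, treeDepth (ℓ + 2))} ∪ shift (nestedIntervals (ℓ + 1)) 1 ∪
      shift (nestedIntervals (ℓ + 1)) (treeDepth (ℓ + 1) + 1)

/-- The nodes of the complete binary tree `B_ℓ` with `h(ℓ)` levels. The root is the empty list, and
the left and right children of `s` are `false :: s` and `true :: s`. -/
abbrev Node (ℓ : ℕ) : Type := {s : List Bool // s.length < treeDepth ℓ}

/-- The depth of a node; the root has depth `1`. -/
def Node.depth {ℓ : ℕ} (s : Node ℓ) : ℕ := s.1.length + 1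

/-- `s` is a proper ancestor of `t`. -/
def Node.IsAncestor {ℓ : ℕ} (s t : Node ℓ) : Prop := s ≠ t ∧ s.1 <:+ t.1

/-- The 16 vertices of a gadget; `false` stands for left and `true` for right. There are two
out-ports, two base vertices, and four arms `(x, y)`, each of which consists of two in-ports (`near`
and `far`) and one connector. The connectors of the arms `(false, y)` are the left connectors, those
of the arms `(true, y)` the right connectors. From left to right, the arms are `(false, false)`,
`(false, true)`, `(true, false)`, `(true, true)`. -/
inductive GadgetVertex : Type
  | out (x : Bool)
  | base (x : Bool)
  | near (x y : Bool)
  | far (x y : Bool)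
  | conn (x y : Bool)

open GadgetVertex

/-- The 17 edges of a gadget. The base vertices and the out-ports form a 4-cycle; the two outer arms
are attached to the base vertices, the two inner arms are joined to each other at their near ends,
and the two connectors on each side are adjacent. -/
inductive GadgetEdge : GadgetVertex → GadgetVertex → Prop
  | out_base (x y : Bool) : GadgetEdge (out x) (base y)
  | base_near (x : Bool) : GadgetEdge (base x) (near x x)
  | near_far (x y : Bool) : GadgetEdge (near x y) (far x y)
  | far_conn (x y : Bool) : GadgetEdge (far x y) (conn x y)
  | conn_conn (x : Bool) : GadgetEdge (conn x false) (conn x true)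
  | near_near : GadgetEdge (near false true) (near true false)

/-- The edges of `G_ℓ`: the gadget edges, the tree edges between connectors of a node and out-ports
of its children, and the ribs from the out-ports of a node of depth `i` to the in-ports of its
descendants of depth `j`, for every interval `(i, j)` of `N_ℓ`. -/
inductive RibbedEdge (ℓ : ℕ) : Node ℓ × GadgetVertex → Node ℓ × GadgetVertex → Prop
  | gadget (s : Node ℓ) (u v : GadgetVertex) (huv : GadgetEdge u v) : RibbedEdge ℓ (s, u) (s, v)
  | tree (s t : Node ℓ) (x y : Bool) (hst : t.1 = x :: s.1) :
      RibbedEdge ℓ (s, conn x y) (t, out y)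
  | rib_left (s t : Node ℓ) (x y : Bool) (hst : s.IsAncestor t)
      (hN : (s.depth, t.depth) ∈ nestedIntervals ℓ) : RibbedEdge ℓ (s, out false) (t, near x y)
  | rib_right (s t : Node ℓ) (x y : Bool) (hst : s.IsAncestor t)
      (hN : (s.depth, t.depth) ∈ nestedIntervals ℓ) : RibbedEdge ℓ (s, out true) (t, far x y)

/-- The graph `G_ℓ`. -/
def ribbedTree (ℓ : ℕ) : SimpleGraph (Node ℓ × GadgetVertex) :=
  SimpleGraph.fromRel (RibbedEdge ℓ)

end OrderedPattern

open OrderedPattern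

/-!
**Induced paths.** In the tree of gadgets, an induced path that enters the subtree of a node
through one of the two edges from the parent never returns, since the two connectors of the parent
on this side are adjacent (`IndPath.no_return`). Hence an induced path splits at its topmost node
into two *rooted* paths, that is, paths which start at an out-port of a node and descend in its
subtree (`IndPath.exists_split`), and only rooted paths have to be bounded.

The intervals of `N_ℓ` are nested in `ℓ` levels, and each of them spans a *block* of depths which
no rib leaves. A rooted path that starts at the root of a block can leave the block only through
an arm of a node at its last depth. Both in-ports of this arm are adjacent to out-ports of the
root, so an induced path crosses a block in boundedly many steps (`IndPath.cross_block`). From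
every depth of a block of level `m`, the depths below split into `O(m)` smaller blocks and single
depths (`IsBlock.cascade`). Let `e(m)` be the largest order of a rooted path that stays in its
block of level `m`. After the last out-port of the root, such a path either descends, or it jumps
along a rib to the last depth and climbs up to a topmost node. In the second case the climb, read
backwards, is a rooted path that crosses all blocks on its way, so that it has order `O(m)`. In
both cases the rest is a rooted path that crosses `O(m)` blocks and single depths before it stays
in one block of level at most `m - 1`. Therefore `e(m) ≤ e(m - 1) + O(m)` and `e(m) = O(m²)`
(`RootPath.length_le_of_inBlock`).

**The Hamiltonian path.** The traversal of the subtree of `s` starts at the left out-port of `s`,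
ends at the right out-port, and traverses the subtree of each child between the two connectors on
its side. The edges off the path are the edges between these two connectors, and the edges of
stars centered at out-ports whose leaves have no other edge. So the two out-ports of `s` are the
first and the last vertex of the subtree of `s` and can be removed with their stars; then the two
sides form a concatenation, and in each side the edge of the first and the last vertex encloses
the subtree of a child (`isConstellationOn_subtreeSet`).

**Patterns.** Constellations are closed under ordered subgraphs
(`IsConstellationOn.of_embedding`), so `G_ℓ` with this path, or with an initial segment of it,
avoids every pattern that is not a constellation. As `G_ℓ` has at least `2 ^ 2 ^ ℓ` vertices, the
choice `ℓ = ⌈log log n⌉` gives the bound for `g_H`. The maximum exists since the path of order `n`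
itself avoids `H`.
-/

open OrderedPattern

namespace OrderedPattern

open SimpleGraph GadgetVertex

/-! ### Adjacency in the graphs `G_ℓ` -/

section

variable {ℓ : ℕ}

theorem adj_conn {t : Node ℓ} {x y : Bool} {w : Node ℓ × GadgetVertex}
    (h : (ribbedTree ℓ).Adj (t, conn x y) w) :
    w = (t, far x y) ∨ w = (t, conn x !y) ∨ ∃ t' : Node ℓ, t'.1 = x :: t.1 ∧ w = (t', out y) := by
  rcases h with ⟨-, h | h⟩
  · cases h with
    | gadget _ _ _ h => cases h; simp
    | tree _ t' _ _ h => exact .inr (.inr ⟨t', h, rfl⟩)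
  · cases h with
    | gadget _ _ _ h => cases h <;> simp

theorem adj_far {t : Node ℓ} {x y : Bool} {w : Node ℓ × GadgetVertex}
    (h : (ribbedTree ℓ).Adj (t, far x y) w) :
    w = (t, near x y) ∨ w = (t, conn x y) ∨ ∃ r : Node ℓ, r.IsAncestor t ∧
      (r.depth, t.depth) ∈ nestedIntervals ℓ ∧ w = (r, out true) := by
  rcases h with ⟨-, h | h⟩
  · cases h with
    | gadget _ _ _ h => cases h; simp
  · cases h with
    | gadget _ _ _ h => cases h; simp
    | rib_right r _ _ _ h h' => exact .inr (.inr ⟨r, h, h', rfl⟩)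

theorem adj_near {t : Node ℓ} {x y : Bool} {w : Node ℓ × GadgetVertex}
    (h : (ribbedTree ℓ).Adj (t, near x y) w) :
    w = (t, far x y) ∨ (x = y ∧ w = (t, base x)) ∨ (x ≠ y ∧ w = (t, near y x)) ∨
      ∃ r : Node ℓ, r.IsAncestor t ∧
      (r.depth, t.depth) ∈ nestedIntervals ℓ ∧ w = (r, out false) := by
  rcases h with ⟨-, h | h⟩
  · cases h with
    | gadget _ _ _ h => cases h <;> simp
  · cases h with
    | gadget _ _ _ h => cases h <;> simp
    | rib_left r _ _ _ h h' => exact .inr (.inr (.inr ⟨r, h, h', rfl⟩))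

theorem adj_base {t : Node ℓ} {x : Bool} {w : Node ℓ × GadgetVertex}
    (h : (ribbedTree ℓ).Adj (t, base x) w) :
    w = (t, out false) ∨ w = (t, out true) ∨ w = (t, near x x) := by
  rcases h with ⟨-, h | h⟩
  · cases h with
    | gadget _ _ _ h => cases h; simp
  · cases h with
    | gadget _ _ _ h => rcases h with ⟨_ | _, _⟩ <;> simp

/-- In-port of an arm receiving the ribs that start at the out-port `out y`. -/
def inPort (y a b : Bool) : GadgetVertex := if y then far a b else near a b

theorem adj_out {t : Node ℓ} {y : Bool} {w : Node ℓ × GadgetVertex}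
    (h : (ribbedTree ℓ).Adj (t, out y) w) :
    (∃ x, w = (t, base x)) ∨ (∃ (u : Node ℓ) (x : Bool), t.1 = x :: u.1 ∧ w = (u, conn x y)) ∨
      ∃ r : Node ℓ, t.IsAncestor r ∧ (t.depth, r.depth) ∈ nestedIntervals ℓ ∧
        ∃ a b, w = (r, inPort y a b) := by
  rcases h with ⟨-, h | h⟩
  · cases h with
    | gadget _ _ _ h => cases h; simp
    | rib_left _ r a b h h' => exact .inr (.inr ⟨r, h, h', a, b, rfl⟩)
    | rib_right _ r a b h h' => exact .inr (.inr ⟨r, h, h', a, b, rfl⟩)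
  · cases h with
    | gadget _ _ _ h => cases h
    | tree u _ x _ h => exact .inr (.inl ⟨u, x, h, rfl⟩)

theorem adj_of_gadgetEdge (s : Node ℓ) {u v : GadgetVertex} (h : GadgetEdge u v) :
    (ribbedTree ℓ).Adj (s, u) (s, v) := by
  refine ⟨?_, .inl (.gadget s u v h)⟩
  cases h <;> simp

theorem adj_conn_out {s t : Node ℓ} {x : Bool} (y : Bool) (h : t.1 = x :: s.1) :
    (ribbedTree ℓ).Adj (s, conn x y) (t, out y) :=
  ⟨by simp, .inl (.tree s t x y h)⟩

theorem adj_conn_conn (s : Node ℓ) {x y z : Bool} (h : y ≠ z) :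
    (ribbedTree ℓ).Adj (s, conn x y) (s, conn x z) := by
  have := adj_of_gadgetEdge s (GadgetEdge.conn_conn x)
  cases y <;> cases z <;> simp_all [this.symm]

theorem adj_rib {s t : Node ℓ} (y a b : Bool) (h : s.IsAncestor t)
    (hN : (s.depth, t.depth) ∈ nestedIntervals ℓ) :
    (ribbedTree ℓ).Adj (s, out y) (t, inPort y a b) := by
  cases y
  · exact ⟨by simp [inPort], .inl (.rib_left s t a b h hN)⟩
  · exact ⟨by simp [inPort], .inl (.rib_right s t a b h hN)⟩

theorem Node.IsAncestor.length_lt {s t : Node ℓ} (h : s.IsAncestor t) :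
    s.1.length < t.1.length := by
  refine lt_of_le_of_ne h.2.length_le fun h' => h.1 (Subtype.ext (h.2.eq_of_length h'))

/-- Ancestors of a node are determined by their depth. -/
theorem suffix_unique {r r' t : Node ℓ} (h : r.1 <:+ t.1) (h' : r'.1 <:+ t.1)
    (hl : r.1.length = r'.1.length) : r = r' := by
  apply Subtype.ext
  exact (List.suffix_of_suffix_length_le h h' hl.le).eq_of_length hl

end

/-! ### Blocks and cascades of depths -/

section

theorem treeDepth_one : treeDepth 1 = 3 := rfl

theorem treeDepth_succ {m : ℕ} (hm : 1 ≤ m) : treeDepth (m + 1) = 2 * treeDepth m + 2 := by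
  obtain ⟨m, rfl⟩ := Nat.exists_eq_add_of_le' hm
  have := Nat.one_le_two_pow (n := m)
  simp only [treeDepth, Nat.add_sub_cancel, pow_succ]
  omega

theorem three_le_treeDepth (m : ℕ) : 3 ≤ treeDepth m := by
  have := Nat.one_le_two_pow (n := m - 1)
  simp only [treeDepth]
  omega

theorem mem_shift {X : Finset (ℕ × ℕ)} {i a b : ℕ} :
    (a, b) ∈ shift X i ↔ ∃ c d, (c, d) ∈ X ∧ a = c + i ∧ b = d + i := by
  simp only [shift, Finset.mem_image, Prod.exists, Prod.mk.injEq]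
  constructor <;> rintro ⟨c, d, h, h1, h2⟩ <;> exact ⟨c, d, h, h1.symm, h2.symm⟩

theorem mem_nestedIntervals_succ {m a b : ℕ} (hm : 1 ≤ m) :
    (a, b) ∈ nestedIntervals (m + 1) ↔ (a = 1 ∧ b = treeDepth (m + 1)) ∨
      (a, b) ∈ shift (nestedIntervals m) 1 ∨
      (a, b) ∈ shift (nestedIntervals m) (treeDepth m + 1) := by
  obtain ⟨m, rfl⟩ := Nat.exists_eq_add_of_le' hm
  simp [nestedIntervals]

theorem nestedIntervals_bounds {m a b : ℕ} (h : (a, b) ∈ nestedIntervals m) :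
    1 ≤ a ∧ a < b ∧ b ≤ treeDepth m := by
  induction m generalizing a b with
  | zero => simp [nestedIntervals] at h
  | succ m ih =>
    rcases Nat.eq_zero_or_pos m with rfl | hm
    · simp only [nestedIntervals, Finset.mem_singleton, Prod.mk.injEq] at h
      simp [h, treeDepth_one]
    · have hd := treeDepth_succ hm
      have h3 := three_le_treeDepth m
      rw [mem_nestedIntervals_succ hm, mem_shift, mem_shift] at h
      rcases h with ⟨rfl, rfl⟩ | ⟨c, d, h, rfl, rfl⟩ | ⟨c, d, h, rfl, rfl⟩
      · omega
      · have := ih h; omega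
      · have := ih h; omega

/-- Every integer is the right end of at most one interval. -/
theorem nestedIntervals_left_unique {m a a' b : ℕ} (h : (a, b) ∈ nestedIntervals m)
    (h' : (a', b) ∈ nestedIntervals m) : a = a' := by
  induction m generalizing a a' b with
  | zero => simp [nestedIntervals] at h
  | succ m ih =>
    rcases Nat.eq_zero_or_pos m with rfl | hm
    · simp only [nestedIntervals, Finset.mem_singleton, Prod.mk.injEq] at h h'
      omega
    · have hd := treeDepth_succ hm
      have h3 := three_le_treeDepth m
      rw [mem_nestedIntervals_succ hm, mem_shift, mem_shift] at h h'
      rcases h with ⟨rfl, rfl⟩ | ⟨c, d, h, rfl, rfl⟩ | ⟨c, d, h, rfl, rfl⟩ <;>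
      rcases h' with ⟨rfl, h'⟩ | ⟨c', d', h', rfl, h2⟩ | ⟨c', d', h', rfl, h2⟩ <;>
      first
      | rfl
      | (have := nestedIntervals_bounds h; omega)
      | (have := nestedIntervals_bounds h'; omega)
      | (have := nestedIntervals_bounds h; have := nestedIntervals_bounds h'; omega)
      | (obtain rfl : d = d' := by omega
         rw [ih h h'])

/-- The depths `o + 1, …, o + treeDepth m` form a block of level `m`: the intervals of `N_ℓ` with an
end among them form a translate of `N_m`. -/
def IsBlock (ℓ m o : ℕ) : Prop :=
  1 ≤ m ∧ shift (nestedIntervals m) o ⊆ nestedIntervals ℓ ∧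
    ∀ a b, (a, b) ∈ nestedIntervals ℓ → (a, b) ∈ shift (nestedIntervals m) o ∨
      ((a ≤ o ∨ o + treeDepth m < a) ∧ (b ≤ o ∨ o + treeDepth m < b))

variable {ℓ m o : ℕ}

theorem isBlock_self (h : 1 ≤ ℓ) : IsBlock ℓ ℓ 0 := by
  have : shift (nestedIntervals ℓ) 0 = nestedIntervals ℓ := by simp [shift]
  exact ⟨h, this.subset, fun a b h => .inl (this.symm ▸ h)⟩

theorem shift_shift (X : Finset (ℕ × ℕ)) (i j : ℕ) : shift (shift X i) j = shift X (i + j) := by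
  ext ⟨a, b⟩
  simp only [mem_shift]
  constructor
  · rintro ⟨c, d, ⟨c', d', h, rfl, rfl⟩, rfl, rfl⟩
    exact ⟨c', d', h, by omega, by omega⟩
  · rintro ⟨c, d, h, rfl, rfl⟩
    exact ⟨_, _, ⟨c, d, h, rfl, rfl⟩, by omega, by omega⟩

theorem mem_shift_nestedIntervals_succ {a b : ℕ} (hm : 1 ≤ m) :
    (a, b) ∈ shift (nestedIntervals (m + 1)) o ↔
      (a = o + 1 ∧ b = o + treeDepth (m + 1)) ∨
      (a, b) ∈ shift (nestedIntervals m) (o + 1) ∨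
      (a, b) ∈ shift (nestedIntervals m) (o + treeDepth m + 1) := by
  have h1 : o + 1 = 1 + o := by omega
  have h2 : o + treeDepth m + 1 = treeDepth m + 1 + o := by omega
  rw [h2, h1, ← shift_shift, ← shift_shift, mem_shift, mem_shift, mem_shift]
  simp only [mem_nestedIntervals_succ hm]
  constructor
  · rintro ⟨c, d, ⟨rfl, rfl⟩ | h | h, rfl, rfl⟩
    · left; omega
    · exact .inr (.inl ⟨c, d, h, rfl, rfl⟩)
    · exact .inr (.inr ⟨c, d, h, rfl, rfl⟩)
  · rintro (⟨rfl, rfl⟩ | ⟨c, d, h, rfl, rfl⟩ | ⟨c, d, h, rfl, rfl⟩)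
    · exact ⟨1, _, .inl ⟨rfl, rfl⟩, by omega, by omega⟩
    · exact ⟨c, d, .inr (.inl h), rfl, rfl⟩
    · exact ⟨c, d, .inr (.inr h), rfl, rfl⟩

theorem shift_bounds {a b : ℕ} (h : (a, b) ∈ shift (nestedIntervals m) o) :
    o + 1 ≤ a ∧ a < b ∧ b ≤ o + treeDepth m := by
  obtain ⟨c, d, hcd, rfl, rfl⟩ := mem_shift.1 h
  have := nestedIntervals_bounds hcd
  omega

theorem IsBlock.upper (h : IsBlock ℓ (m + 1) o) (hm : 1 ≤ m) : IsBlock ℓ m (o + 1) := by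
  have hd := treeDepth_succ hm
  refine ⟨hm, fun ⟨a, b⟩ hab => h.2.1 ((mem_shift_nestedIntervals_succ hm).2 (.inr (.inl hab))),
    fun a b hab => ?_⟩
  rcases h.2.2 a b hab with h' | h'
  · rcases (mem_shift_nestedIntervals_succ hm).1 h' with h' | h' | h'
    · right; omega
    · exact .inl h'
    · have := shift_bounds h'; right; omega
  · right; omega

theorem IsBlock.lower (h : IsBlock ℓ (m + 1) o) (hm : 1 ≤ m) :
    IsBlock ℓ m (o + treeDepth m + 1) := by
  have hd := treeDepth_succ hm
  refine ⟨hm, fun ⟨a, b⟩ hab => h.2.1 ((mem_shift_nestedIntervals_succ hm).2 (.inr (.inr hab))),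
    fun a b hab => ?_⟩
  rcases h.2.2 a b hab with h' | h'
  · rcases (mem_shift_nestedIntervals_succ hm).1 h' with h' | h' | h'
    · right; omega
    · have := shift_bounds h'; right; omega
    · exact .inl h'
  · right; omega

theorem one_treeDepth_mem (hm : 1 ≤ m) : (1, treeDepth m) ∈ nestedIntervals m := by
  obtain ⟨m, rfl⟩ := Nat.exists_eq_add_of_le' hm
  rcases Nat.eq_zero_or_pos m with rfl | h
  · simp [nestedIntervals, treeDepth_one]
  · rw [mem_nestedIntervals_succ h]; simp

theorem IsBlock.ends_mem (h : IsBlock ℓ m o) : (o + 1, o + treeDepth m) ∈ nestedIntervals ℓ :=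
  h.2.1 (mem_shift.2 ⟨_, _, one_treeDepth_mem h.1, by omega, by omega⟩)

/-- No interval starts at the first depth of a block, except the one that spans the block. -/
theorem IsBlock.right_eq (h : IsBlock ℓ m o) {b : ℕ} (hb : (o + 1, b) ∈ nestedIntervals ℓ) :
    b = o + treeDepth m := by
  have h3 := three_le_treeDepth m
  rcases h.2.2 _ _ hb with h' | h'
  · obtain ⟨m, rfl⟩ := Nat.exists_eq_add_of_le' h.1
    rcases Nat.eq_zero_or_pos m with rfl | hm
    · simp only [nestedIntervals, mem_shift, Finset.mem_singleton, Prod.mk.injEq] at h'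
      have := treeDepth_one
      simp only [zero_add]
      omega
    · rcases (mem_shift_nestedIntervals_succ hm).1 h' with h' | h' | h'
      · exact h'.2
      · have := shift_bounds h'; omega
      · have := shift_bounds h'; omega
  · omega

/-- No interval starts in a block and ends below it. -/
theorem IsBlock.right_le (h : IsBlock ℓ m o) {a b : ℕ} (hab : (a, b) ∈ nestedIntervals ℓ)
    (h1 : o < a) (h2 : a ≤ o + treeDepth m) : b ≤ o + treeDepth m := by
  rcases h.2.2 _ _ hab with h' | h'
  · exact (shift_bounds h').2.2
  · omega

/-- `Cascade ℓ M a e n`: the depths `a + 1, …, e` split into `n` consecutive parts, each of which is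
a block of level at most `M` or a single depth where no interval starts. -/
inductive Cascade (ℓ M : ℕ) : ℕ → ℕ → ℕ → Prop
  | nil (e : ℕ) : Cascade ℓ M e e 0
  | plain {a e n : ℕ} (h : ∀ b, (a + 1, b) ∉ nestedIntervals ℓ) (hr : Cascade ℓ M (a + 1) e n) :
      Cascade ℓ M a e (n + 1)
  | block {a e n m : ℕ} (h : IsBlock ℓ m a) (hm : m ≤ M) (hr : Cascade ℓ M (a + treeDepth m) e n) :
      Cascade ℓ M a e (n + 1)

theorem Cascade.le {M a e n : ℕ} (h : Cascade ℓ M a e n) : a ≤ e := by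
  induction h <;> omega

theorem Cascade.mono {M M' a e n : ℕ} (h : Cascade ℓ M a e n) (hM : M ≤ M') :
    Cascade ℓ M' a e n := by
  induction h with
  | nil e => exact .nil e
  | plain h _ ih => exact .plain h ih
  | block h hm _ ih => exact .block h (hm.trans hM) ih

theorem Cascade.append {M a e e' n n' : ℕ} (h : Cascade ℓ M a e n) (h' : Cascade ℓ M e e' n') :
    Cascade ℓ M a e' (n + n') := by
  induction h with
  | nil e => simpa using h'
  | plain h _ ih => rw [Nat.add_right_comm]; exact .plain h (ih h')
  | block h hm _ ih => rw [Nat.add_right_comm]; exact .block h hm (ih h')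

theorem IsBlock.cascade_last {M : ℕ} (h : IsBlock ℓ m o) :
    Cascade ℓ M (o + treeDepth m - 1) (o + treeDepth m) 1 := by
  have h3 := three_le_treeDepth m
  have : o + treeDepth m - 1 + 1 = o + treeDepth m := by omega
  have h' := Cascade.plain (ℓ := ℓ) (M := M) (a := o + treeDepth m - 1) (fun b hb => ?_)
    (Cascade.nil _)
  · rwa [this] at h'
  · have h1 := nestedIntervals_bounds hb
    have h2 := h.right_le hb (by omega) (by omega)
    omega

/-- From any depth inside a block of level `m`, linearly many parts of lower level lead to the last
depth of the block. -/
theorem IsBlock.cascade {m o : ℕ} (h : IsBlock ℓ (m + 1) o) {a : ℕ} (h1 : o < a)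
    (h2 : a < o + treeDepth (m + 1)) :
    ∃ n ≤ 2 * m + 1, Cascade ℓ m a (o + treeDepth (m + 1) - 1) n := by
  induction m generalizing o a with
  | zero =>
    rw [zero_add, treeDepth_one] at *
    obtain rfl | rfl : a = o + 1 ∨ a = o + 2 := by omega
    · refine ⟨1, le_rfl, .plain (fun b hb => ?_) (.nil _)⟩
      rcases h.2.2 _ _ hb with h' | h'
      · simp only [nestedIntervals, mem_shift, Finset.mem_singleton, Prod.mk.injEq] at h'
        omega
      · rw [treeDepth_one] at h'; omega
    · exact ⟨0, by omega, .nil _⟩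
  | succ m ih =>
    have hd := treeDepth_succ (m := m + 1) (by omega)
    have hu := h.upper (by omega)
    have hl := h.lower (by omega)
    have hlast : Cascade ℓ (m + 1) (o + treeDepth (m + 1) + 1)
        (o + treeDepth (m + 1 + 1) - 1) 1 := by
      have h' := Cascade.block hl le_rfl (.nil _)
      convert h' using 1
      omega
    have h3 := three_le_treeDepth (m + 1)
    by_cases ha : a < o + 1 + treeDepth (m + 1)
    · rcases Nat.lt_or_ge (o + 1) a with ha' | ha'
      · obtain ⟨n, hn, hc⟩ := ih hu ha' ha
        refine ⟨n + 1 + 1, by omega, ((hc.mono (Nat.le_succ m)).append hu.cascade_last).append ?_⟩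
        convert hlast using 1
        omega
      · obtain rfl : a = o + 1 := by omega
        refine ⟨1 + 1, by omega, .block hu le_rfl ?_⟩
        convert hlast using 1
        omega
    · rcases Nat.lt_or_ge (o + treeDepth (m + 1) + 1) a with ha' | ha'
      · by_cases ha2 : a < o + treeDepth (m + 1) + 1 + treeDepth (m + 1)
        · obtain ⟨n, hn, hc⟩ := ih hl ha' ha2
          refine ⟨n + 1, by omega, ?_⟩
          convert (hc.mono (Nat.le_succ m)).append hl.cascade_last using 1
          omega
        · refine ⟨0, by omega, ?_⟩
          obtain rfl : a = o + treeDepth (m + 1 + 1) - 1 := by omega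
          exact .nil _
      · obtain rfl : a = o + treeDepth (m + 1) + 1 := by omega
        exact ⟨1, by omega, hlast⟩

end

/-! ### Degeneracy -/

section

variable {ℓ : ℕ}

/-- Position in an elimination order of the gadget, from the out-ports to the connectors. -/
def GadgetVertex.rank : GadgetVertex → ℕ
  | out _ => 0
  | base _ => 1
  | near _ _ => 2
  | far _ _ => 3
  | conn _ _ => 4

theorem rib_origin_unique {r r' t : Node ℓ} (h : r.IsAncestor t) (h' : r'.IsAncestor t)
    (hN : (r.depth, t.depth) ∈ nestedIntervals ℓ) (hN' : (r'.depth, t.depth) ∈ nestedIntervals ℓ) :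
    r = r' := by
  have := nestedIntervals_left_unique hN hN'
  simp only [Node.depth] at this
  exact suffix_unique h.2 h'.2 (by omega)

theorem ncard_le_two {V : Type} {S : Set V} (a : V) (h : ∀ v ∈ S, ∀ w ∈ S, v ≠ a → w ≠ a → v = w) :
    S.ncard ≤ 2 := by
  by_cases hb : ∃ b ∈ S, b ≠ a
  · obtain ⟨b, hb, hba⟩ := hb
    refine (Set.ncard_le_ncard (t := {a, b}) (fun v hv => ?_) (Set.toFinite _)).trans
      ((Set.ncard_insert_le _ _).trans (by simp))
    by_cases hva : v = a
    · simp [hva]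
    · simp [h v hv b hb hva hba]
  · push Not at hb
    refine (Set.ncard_le_ncard (t := {a}) (fun v hv => hb v hv) (Set.toFinite _)).trans (by simp)

/-- A vertex at the deepest node, and there the last in the order of `rank`, has at most two
neighbors. -/
theorem isDegenerate_ribbedTree (ℓ : ℕ) : IsDegenerate 2 (ribbedTree ℓ) := by
  intro S hS
  obtain ⟨⟨t, g⟩, hv, hmax⟩ := S.exists_max_image (fun v => 5 * v.1.1.length + v.2.rank) hS
  refine ⟨(t, g), hv, ?_⟩
  cases g with
  | conn x y =>
    refine ncard_le_two (t, far x y) fun v hv w hw hv' hw' => ?_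
    have key : ∀ v, v ∈ S ∧ (ribbedTree ℓ).Adj (t, conn x y) v → v ≠ (t, far x y) →
        v = (t, conn x !y) := by
      rintro v ⟨hv, hadj⟩ hne
      rcases adj_conn hadj with rfl | rfl | ⟨t', ht', rfl⟩
      · exact absurd rfl hne
      · rfl
      · have := hmax _ hv
        simp only [rank, ht', List.length_cons] at this
        omega
    rw [key v hv hv', key w hw hw']
  | far x y =>
    refine ncard_le_two (t, near x y) fun v hv w hw hv' hw' => ?_
    have key : ∀ v, v ∈ S ∧ (ribbedTree ℓ).Adj (t, far x y) v → v ≠ (t, near x y) →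
        ∃ r : Node ℓ, r.IsAncestor t ∧ (r.depth, t.depth) ∈ nestedIntervals ℓ ∧
          v = (r, out true) := by
      rintro v ⟨hv, hadj⟩ hne
      rcases adj_far hadj with rfl | rfl | h
      · exact absurd rfl hne
      · have := hmax _ hv
        simp [rank] at this
      · exact h
    obtain ⟨r, h1, h2, rfl⟩ := key v hv hv'
    obtain ⟨r', h1', h2', rfl⟩ := key w hw hw'
    rw [rib_origin_unique h1 h1' h2 h2']
  | near x y =>
    refine ncard_le_two (if x = y then (t, base x) else (t, near y x)) fun v hv w hw hv' hw' => ?_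
    have key : ∀ v, v ∈ S ∧ (ribbedTree ℓ).Adj (t, near x y) v →
        v ≠ (if x = y then (t, base x) else (t, near y x)) →
        ∃ r : Node ℓ, r.IsAncestor t ∧ (r.depth, t.depth) ∈ nestedIntervals ℓ ∧
          v = (r, out false) := by
      rintro v ⟨hv, hadj⟩ hne
      rcases adj_near hadj with rfl | ⟨h, rfl⟩ | ⟨h, rfl⟩ | h
      · have := hmax _ hv
        simp [rank] at this
      · simp [h] at hne
      · simp [h] at hne
      · exact h
    obtain ⟨r, h1, h2, rfl⟩ := key v hv hv'
    obtain ⟨r', h1', h2', rfl⟩ := key w hw hw'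
    rw [rib_origin_unique h1 h1' h2 h2']
  | base x =>
    refine ncard_le_two (t, out false) fun v hv w hw hv' hw' => ?_
    have key : ∀ v, v ∈ S ∧ (ribbedTree ℓ).Adj (t, base x) v → v ≠ (t, out false) →
        v = (t, out true) := by
      rintro v ⟨hv, hadj⟩ hne
      rcases adj_base hadj with rfl | rfl | rfl
      · exact absurd rfl hne
      · rfl
      · have := hmax _ hv
        simp [rank] at this
    rw [key v hv hv', key w hw hw']
  | out y =>
    refine ncard_le_two (t, out y) fun v hv w hw _ _ => ?_
    have key : ∀ v, v ∈ S ∧ (ribbedTree ℓ).Adj (t, out y) v →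
        ∃ (u : Node ℓ) (x : Bool), t.1 = x :: u.1 ∧ v = (u, conn x y) := by
      rintro v ⟨hv, hadj⟩
      rcases adj_out hadj with ⟨x, rfl⟩ | h | ⟨r, h1, h2, a, b, rfl⟩
      · have := hmax _ hv
        simp [rank] at this
      · exact h
      · have := hmax _ hv
        have := h1.length_lt
        simp only [rank] at *
        omega
    obtain ⟨u, x, h, rfl⟩ := key v hv
    obtain ⟨u', x', h', rfl⟩ := key w hw
    obtain ⟨h1, h2⟩ := List.cons_eq_cons.1 (h.symm.trans h')
    rw [h1, Subtype.ext h2]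

end

/-! ### Induced paths and subtrees -/

section

/-- The vertices `f 0, …, f (n - 1)` form, in this order, an induced path of `G`. -/
structure IndPath {V : Type} (G : SimpleGraph V) (f : ℕ → V) (n : ℕ) : Prop where
  inj : ∀ i j, i < n → j < n → f i = f j → i = j
  adj : ∀ i j, i < n → j < n → (G.Adj (f i) (f j) ↔ i + 1 = j ∨ j + 1 = i)

namespace IndPath

variable {V : Type} {G : SimpleGraph V} {f : ℕ → V} {n : ℕ}

theorem sub (h : IndPath G f n) {a m : ℕ} (ham : a + m ≤ n) :
    IndPath G (fun i => f (a + i)) m := by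
  refine ⟨fun i j hi hj hij => ?_, fun i j hi hj => ?_⟩
  · have := h.inj _ _ (by omega) (by omega) hij
    omega
  · rw [h.adj _ _ (by omega) (by omega)]
    omega

theorem take (h : IndPath G f n) {m : ℕ} (ham : m ≤ n) : IndPath G f m :=
  ⟨fun i j hi hj => h.inj i j (by omega) (by omega),
    fun i j hi hj => h.adj i j (by omega) (by omega)⟩

theorem rev (h : IndPath G f n) {m : ℕ} (hm : m < n) :
    IndPath G (fun i => f (m - i)) (m + 1) := by
  refine ⟨fun i j hi hj hij => ?_, fun i j hi hj => ?_⟩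
  · have := h.inj _ _ (by omega) (by omega) hij
    omega
  · rw [h.adj _ _ (by omega) (by omega)]
    omega

theorem succ (h : IndPath G f n) {i : ℕ} (hi : i + 1 < n) : G.Adj (f i) (f (i + 1)) :=
  (h.adj _ _ (by omega) hi).2 (.inl rfl)

theorem pred (h : IndPath G f n) {i : ℕ} (hi : i < n) (h0 : i ≠ 0) : G.Adj (f i) (f (i - 1)) :=
  (h.adj _ _ hi (by omega)).2 (by omega)

end IndPath

variable {ℓ : ℕ}

/-- The vertex `v` belongs to a node of the subtree rooted at `s`. -/
def Below (s : Node ℓ) (v : Node ℓ × GadgetVertex) : Prop := s.1 <:+ v.1.1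

theorem Below.length_le {s : Node ℓ} {v : Node ℓ × GadgetVertex} (h : Below s v) :
    s.1.length ≤ v.1.1.length := List.IsSuffix.length_le h

theorem Below.node_eq {s : Node ℓ} {v : Node ℓ × GadgetVertex} (h : Below s v)
    (hl : v.1.1.length ≤ s.1.length) : v.1 = s :=
  (Subtype.ext (List.IsSuffix.eq_of_length h (le_antisymm h.length_le hl))).symm

/-- The edges leaving the subtree rooted at `t` are the two edges to the parent of `t` and the ribs
that start at proper ancestors of `t`. -/
theorem boundary {t : Node ℓ} {v w : Node ℓ × GadgetVertex} (hv : Below t v) (hw : ¬ Below t w)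
    (h : (ribbedTree ℓ).Adj v w) :
    (∃ (u : Node ℓ) (x y : Bool), t.1 = x :: u.1 ∧ v = (t, out y) ∧ w = (u, conn x y)) ∨
      ∃ (r : Node ℓ) (y : Bool), r.IsAncestor t ∧ (r.depth, v.1.depth) ∈ nestedIntervals ℓ ∧
        w = (r, out y) := by
  have hrib : ∀ {r s : Node ℓ}, r.IsAncestor s → t.1 <:+ s.1 → ¬ t.1 <:+ r.1 → r.IsAncestor t := by
    intro r s h1 h2 h3
    refine ⟨fun h => h3 (h ▸ List.suffix_rfl), ?_⟩
    exact (List.suffix_or_suffix_of_suffix h1.2 h2).resolve_right h3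
  rcases h with ⟨-, h | h⟩
  · cases h with
    | gadget => exact absurd hv hw
    | tree s t' x y h =>
      exact absurd (List.IsSuffix.trans hv (h ▸ List.suffix_cons x s.1)) hw
    | rib_left s t' x y h => exact absurd (List.IsSuffix.trans hv h.2) hw
    | rib_right s t' x y h => exact absurd (List.IsSuffix.trans hv h.2) hw
  · cases h with
    | gadget => exact absurd hv hw
    | tree s t' x y h =>
      left
      have hv' : t.1 <:+ x :: s.1 := h ▸ hv
      rcases List.suffix_cons_iff.1 hv' with h' | h'
      · obtain rfl : t = t' := Subtype.ext (h'.trans h.symm)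
        exact ⟨s, x, y, h', rfl, rfl⟩
      · exact absurd h' hw
    | rib_left s t' x y h hN => exact .inr ⟨s, _, hrib h hv hw, hN, rfl⟩
    | rib_right s t' x y h hN => exact .inr ⟨s, _, hrib h hv hw, hN, rfl⟩

/-- An induced path that starts at an out-port of `s` and stays in the subtree rooted at `s`. -/
structure RootPath (s : Node ℓ) (f : ℕ → Node ℓ × GadgetVertex) (n : ℕ) : Prop where
  path : IndPath (ribbedTree ℓ) f n
  pos : 0 < n
  start : ∃ y, f 0 = (s, out y)
  below : ∀ i < n, Below s (f i)

variable {f : ℕ → Node ℓ × GadgetVertex} {n : ℕ} {s : Node ℓ}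

/-- An induced path that enters a subtree through a tree edge does not leave it, unless a rib
leads out: the only other tree edge out of the subtree would close a cycle. -/
theorem IndPath.no_return (h : IndPath (ribbedTree ℓ) f n) {t t' : Node ℓ} {x y : Bool} {k : ℕ}
    (hk : k + 1 < n) (hfk : f k = (t, conn x y)) (hfk' : f (k + 1) = (t', out y))
    (ht' : t'.1 = x :: t.1)
    (hrib : ∀ (r : Node ℓ) z i j, i < n → j < n → Below t' (f i) → r.IsAncestor t' →
      f j = (r, out z) → (r.depth, (f i).1.depth) ∈ nestedIntervals ℓ → False) :
    RootPath t' (fun i => f (k + 1 + i)) (n - (k + 1)) := by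
  refine ⟨h.sub (by omega), by omega, ⟨y, hfk'⟩, fun i hi => ?_⟩
  induction i with
  | zero => simp only [add_zero, hfk']; exact List.suffix_rfl
  | succ i ih =>
    by_contra hb
    rcases boundary (ih (by omega)) hb (h.succ (by omega)) with
      ⟨u, x', z, hu, h1, h2⟩ | ⟨r, z, hr, hN, h2⟩
    · -- The path would leave to a connector of `t`, which is equal or adjacent to `f k`.
      obtain ⟨rfl, hu'⟩ := List.cons_eq_cons.1 (ht'.symm.trans hu)
      obtain rfl : t = u := Subtype.ext hu'
      by_cases hz : y = z
      · have := h.inj (k + 1 + (i + 1)) k (by omega) (by omega)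
          (by rw [hfk, ← add_assoc, hz]; exact h2)
        omega
      · have := adj_conn_conn t (x := x) hz
        rw [← hfk, ← h2, h.adj _ _ (by omega) (by omega)] at this
        omega
    · exact hrib r z _ _ (by omega) (by omega) (ih (by omega)) hr h2 hN

/-- An injective encoding of the gadget vertices in a set with 20 elements. -/
def gadgetCode : GadgetVertex → Fin 5 × Bool × Bool
  | out x => (0, x, x)
  | base x => (1, x, x)
  | near x y => (2, x, y)
  | far x y => (3, x, y)
  | conn x y => (4, x, y)

theorem gadgetCode_injective : Function.Injective gadgetCode := by
  rintro (_ | _ | _ | _ | _) (_ | _ | _ | _ | _) <;> simp [gadgetCode]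

theorem IndPath.length_le_of_gadget (h : IndPath (ribbedTree ℓ) f n) (hs : ∀ i < n, (f i).1 = s) :
    n ≤ 20 := by
  have hinj : Function.Injective fun i : Fin n => gadgetCode (f i).2 := by
    intro i j hij
    have hg := gadgetCode_injective hij
    exact Fin.ext (h.inj _ _ i.2 j.2 (Prod.ext ((hs i i.2).trans (hs j j.2).symm) hg))
  simpa using Fintype.card_le_of_injective _ hinj

/-- A path that starts in a gadget soon ends or leaves the gadget. -/
theorem IndPath.first_exit (h : IndPath (ribbedTree ℓ) f n) (h0 : (f 0).1 = s) :
    n ≤ 20 ∨ ∃ k, k + 1 ≤ 20 ∧ k + 1 < n ∧ (f k).1 = s ∧ (f (k + 1)).1 ≠ s := by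
  classical
  by_cases hall : ∀ i < n, (f i).1 = s
  · exact .inl (h.length_le_of_gadget hall)
  push Not at hall
  right
  have hk := Nat.find_spec hall
  have hmin : ∀ i < Nat.find hall, (f i).1 = s := fun i hi => by
    have := Nat.find_min hall hi
    push Not at this
    exact this (by omega)
  generalize Nat.find hall = k at hk hmin
  obtain ⟨hkn, hks⟩ := hk
  obtain ⟨k, rfl⟩ : ∃ k', k = k' + 1 :=
    Nat.exists_eq_succ_of_ne_zero (by rintro rfl; exact hks h0)
  exact ⟨k, (h.take hkn.le).length_le_of_gadget hmin, hkn, hmin k (by omega), hks⟩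

/-- A path in the subtree rooted at `s` which starts in the gadget of `s` and uses no rib of `s`
quickly ends or becomes a path rooted at a child of `s`. -/
theorem IndPath.leave_gadget (h : IndPath (ribbedTree ℓ) f n) (hb : ∀ i < n, Below s (f i))
    (h0 : (f 0).1 = s)
    (hrib : ∀ z i b, i < n → f i = (s, out z) → (s.depth, b) ∉ nestedIntervals ℓ) :
    n ≤ 20 ∨ ∃ k ≤ 20, k < n ∧ ∃ (t : Node ℓ) (x : Bool), t.1 = x :: s.1 ∧
      RootPath t (fun i => f (k + i)) (n - k) := by
  rcases h.first_exit h0 with hn | ⟨k, hk20, hkn, hfk, hks⟩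
  · exact .inl hn
  refine .inr ⟨k + 1, hk20, hkn, ?_⟩
  have hadj := h.succ hkn
  obtain ⟨g, hg⟩ : ∃ g, f k = (s, g) := ⟨(f k).2, Prod.ext hfk rfl⟩
  obtain ⟨t, x, y, ht, hg', hw⟩ : ∃ (t : Node ℓ) (x y : Bool), t.1 = x :: s.1 ∧ g = conn x y ∧
      f (k + 1) = (t, out y) := by
    have hbk := hb (k + 1) hkn
    rw [hg] at hadj
    rcases hadj with ⟨-, hadj | hadj⟩
    · generalize hw : f (k + 1) = w at *
      cases hadj with
      | gadget => exact absurd rfl hks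
      | tree _ t x y ht => exact ⟨t, x, y, ht, rfl, rfl⟩
      | rib_left _ t _ _ _ hN => exact absurd hN (hrib _ k _ (by omega) hg)
      | rib_right _ t _ _ _ hN => exact absurd hN (hrib _ k _ (by omega) hg)
    · generalize hw : f (k + 1) = w at *
      have := hbk.length_le
      cases hadj with
      | gadget => exact absurd rfl hks
      | tree u _ x y ht => simp [ht] at this
      | rib_left r _ _ _ hr => exact absurd hr.length_lt (not_lt.2 this)
      | rib_right r _ _ _ hr => exact absurd hr.length_lt (not_lt.2 this)
  subst hg'
  refine ⟨t, x, ht, h.no_return hkn hg hw ht fun r z i j hi hj _ hr hfj hN => ?_⟩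
  have h1 := (hb j hj).length_le
  have h2 := hr.length_lt
  rw [hfj] at h1
  rw [ht, List.length_cons] at h2
  have h3 := (hb j hj).node_eq (by rw [hfj]; change r.1.length ≤ _; omega)
  rw [hfj] at h3
  obtain rfl : r = s := h3
  exact hrib z j _ hj hfj hN

/-- A nonempty induced path has a vertex in the gadget of a node whose subtree contains it. -/
theorem IndPath.exists_top (h : IndPath (ribbedTree ℓ) f n) (hn : 0 < n) :
    ∃ w : Node ℓ, (∃ i < n, (f i).1 = w) ∧ ∀ i < n, Below w (f i) := by
  induction n, hn using Nat.le_induction with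
  | base =>
    exact ⟨(f 0).1, ⟨0, by omega, rfl⟩, fun i hi => by
      obtain rfl : i = 0 := by omega
      exact List.suffix_rfl⟩
  | succ n hn ih =>
    obtain ⟨w, ⟨i, hi, hw⟩, hb⟩ := ih (h.take (Nat.le_succ n))
    by_cases hbn : Below w (f n)
    · exact ⟨w, ⟨i, by omega, hw⟩, fun j hj => by
        rcases Nat.lt_succ_iff_lt_or_eq.1 hj with h | rfl
        exacts [hb j h, hbn]⟩
    · have hadj := h.pred (i := n) (by omega) (by omega)
      have hanc : (f n).1.1 <:+ w.1 := by
        rcases boundary (hb (n - 1) (by omega)) hbn hadj.symm with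
          ⟨u, x, y, hu, -, h2⟩ | ⟨r, y, hr, -, h2⟩
        · rw [h2, hu]; exact List.suffix_cons _ _
        · rw [h2]; exact hr.2
      refine ⟨(f n).1, ⟨n, by omega, rfl⟩, fun j hj => ?_⟩
      rcases Nat.lt_succ_iff_lt_or_eq.1 hj with h | rfl
      exacts [hanc.trans (hb j h), List.suffix_rfl]

end

/-! ### Paths in a block -/

section

variable {ℓ m : ℕ} {s t : Node ℓ} {f : ℕ → Node ℓ × GadgetVertex} {n : ℕ}

/-- The node `t` is a descendant of `s` at the last depth of a block of level `m` which starts at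
the depth of `s`. -/
def Bottom (m : ℕ) (s t : Node ℓ) : Prop :=
  s.1 <:+ t.1 ∧ t.1.length + 1 = s.1.length + treeDepth m

theorem Bottom.isAncestor (h : Bottom m s t) : s.IsAncestor t := by
  refine ⟨?_, h.1⟩
  rintro rfl
  have := three_le_treeDepth m
  have := h.2
  omega

theorem Bottom.mem (h : Bottom m s t) (hB : IsBlock ℓ m s.1.length) :
    (s.depth, t.depth) ∈ nestedIntervals ℓ := by
  rw [Node.depth, Node.depth, h.2]
  exact hB.ends_mem

theorem Bottom.adj_inPort (h : Bottom m s t) (hB : IsBlock ℓ m s.1.length) (y a b : Bool) :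
    (ribbedTree ℓ).Adj (s, out y) (t, inPort y a b) :=
  adj_rib y a b h.isAncestor (h.mem hB)

theorem Bottom.origin_eq (h : Bottom m s t) (hB : IsBlock ℓ m s.1.length) {r : Node ℓ}
    (hr : r.IsAncestor t) (hN : (r.depth, t.depth) ∈ nestedIntervals ℓ) : r = s :=
  rib_origin_unique hr h.isAncestor hN (h.mem hB)

theorem bottom_of_rib (hB : IsBlock ℓ m s.1.length) (hst : s.IsAncestor t)
    (hN : (s.depth, t.depth) ∈ nestedIntervals ℓ) : Bottom m s t :=
  ⟨hst.2, hB.right_eq hN⟩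

/-- The vertex `v` belongs to the block of level `m` at the top of the subtree rooted at `s`. -/
def InBlock (m : ℕ) (s : Node ℓ) (v : Node ℓ × GadgetVertex) : Prop :=
  Below s v ∧ v.1.1.length < s.1.length + treeDepth m

theorem Bottom.adj_conn {w : Node ℓ × GadgetVertex} {x y : Bool} (h : Bottom m s t)
    (hw : InBlock m s w) (hadj : (ribbedTree ℓ).Adj (t, conn x y) w) :
    w = (t, far x y) ∨ w = (t, conn x !y) := by
  rcases OrderedPattern.adj_conn hadj with h' | h' | ⟨t', ht', rfl⟩
  · exact .inl h'
  · exact .inr h'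
  · have := hw.2
    have := h.2
    simp only [ht', List.length_cons] at *
    omega

theorem Bottom.adj_far {w : Node ℓ × GadgetVertex} {x y : Bool} (h : Bottom m s t)
    (hB : IsBlock ℓ m s.1.length) (hadj : (ribbedTree ℓ).Adj (t, far x y) w) :
    w = (t, near x y) ∨ w = (t, conn x y) ∨ w = (s, out true) := by
  rcases OrderedPattern.adj_far hadj with h' | h' | ⟨r, hr, hN, rfl⟩
  · exact .inl h'
  · exact .inr (.inl h')
  · rw [h.origin_eq hB hr hN]; simp

theorem adj_block_root {w : Node ℓ × GadgetVertex} {y : Bool} (hB : IsBlock ℓ m s.1.length)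
    (hw : Below s w) (hadj : (ribbedTree ℓ).Adj (s, out y) w) :
    (∃ x, w = (s, base x)) ∨ ∃ (t : Node ℓ) (a b : Bool), Bottom m s t ∧ w = (t, inPort y a b) := by
  rcases adj_out hadj with h' | ⟨u, x, hu, rfl⟩ | ⟨r, hr, hN, a, b, rfl⟩
  · exact .inl h'
  · have := hw.length_le
    simp [hu] at this
  · exact .inr ⟨r, a, b, bottom_of_rib hB hr hN, rfl⟩

theorem IndPath.eq_one_of_adj (h : IndPath (ribbedTree ℓ) f n) {i : ℕ} (hi : i < n)
    (hadj : (ribbedTree ℓ).Adj (f 0) (f i)) : i = 1 := by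
  rw [h.adj _ _ (by omega) hi] at hadj
  omega

theorem adj_out_base (s : Node ℓ) (x y : Bool) : (ribbedTree ℓ).Adj (s, out x) (s, base y) :=
  adj_of_gadgetEdge s (.out_base x y)

/-- Inside a block, an induced path between the two out-ports of the root goes through a base vertex
or through one arm at the bottom. -/
theorem IndPath.left_to_right (h : IndPath (ribbedTree ℓ) f n) (hB : IsBlock ℓ m s.1.length)
    (hb : ∀ i < n, InBlock m s (f i)) (h0 : f 0 = (s, out false)) {k : ℕ} (hk : k < n)
    (hfk : f k = (s, out true)) : k ≤ 3 := by
  have hk0 : k ≠ 0 := by rintro rfl; simp [h0] at hfk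
  have h1 := h.pred hk hk0
  rw [hfk] at h1
  rcases adj_block_root hB (hb _ (by omega)).1 h1 with ⟨x, hx⟩ | ⟨t, a, b, ht, hx⟩
  · have := h.eq_one_of_adj (i := k - 1) (by omega) (by rw [h0, hx]; exact adj_out_base ..)
    omega
  · have hx : f (k - 1) = (t, far a b) := hx
    have hk1 : k - 1 ≠ 0 := fun h' => by rw [h', h0] at hx; simp at hx
    have h2 := h.pred (i := k - 1) (by omega) hk1
    rw [hx] at h2
    rcases ht.adj_far hB h2 with h' | h' | h'
    · have := h.eq_one_of_adj (i := k - 1 - 1) (by omega)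
        (by rw [h0, h']; exact ht.adj_inPort hB false a b)
      omega
    · have hk2 : k - 1 - 1 ≠ 0 := fun h3 => by rw [h3, h0] at h'; simp at h'
      have h3 := h.pred (i := k - 1 - 1) (by omega) hk2
      rw [h'] at h3
      rcases ht.adj_conn (hb _ (by omega)) h3 with h4 | h4
      · have := h.inj _ _ (by omega) (by omega) (h4.trans hx.symm)
        omega
      · have hk3 : k - 1 - 1 - 1 ≠ 0 := fun h3 => by rw [h3, h0] at h4; simp at h4
        have h5 := h.pred (i := k - 1 - 1 - 1) (by omega) hk3
        rw [h4] at h5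
        rcases ht.adj_conn (hb _ (by omega)) h5 with h6 | h6
        · have := ht.adj_inPort hB true a !b
          rw [← hfk, inPort, if_pos rfl, ← h6, h.adj _ _ (by omega) (by omega)] at this
          omega
        · rw [Bool.not_not] at h6
          have := h.inj _ _ (by omega) (by omega) (h6.trans h'.symm)
          omega
    · have := h.inj _ _ (by omega) (by omega) (h'.trans hfk.symm)
      omega

/-- The case of a path from the right to the left out-port follows by reversal. -/
theorem IndPath.out_to_out (h : IndPath (ribbedTree ℓ) f n) (hB : IsBlock ℓ m s.1.length)
    (hb : ∀ i < n, InBlock m s (f i)) {y z : Bool} (h0 : f 0 = (s, out y)) {k : ℕ} (hk : k < n)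
    (hfk : f k = (s, out z)) : k ≤ 3 := by
  by_cases hyz : y = z
  · subst hyz
    have := h.inj _ _ (by omega) hk (h0.trans hfk.symm)
    omega
  · cases y
    · cases z
      · exact absurd rfl hyz
      · exact h.left_to_right hB hb h0 hk hfk
    · cases z
      · exact (h.rev hk).left_to_right hB (fun i _ => hb _ (by omega)) (by simpa using hfk)
          (k := k) (by omega) (by simpa using h0)
      · exact absurd rfl hyz

/-- An induced path that crosses a block from its root to the bottom is short: it passes through an
arm at the bottom, and the in-ports of this arm are adjacent to the out-ports of the root. -/
theorem IndPath.cross_block (h : IndPath (ribbedTree ℓ) f n) (hB : IsBlock ℓ m s.1.length)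
    (hb : ∀ i < n, InBlock m s (f i)) {y : Bool} (h0 : f 0 = (s, out y)) {k : ℕ} (hk : k < n)
    {x z : Bool} (ht : Bottom m s t) (hfk : f k = (t, conn x z)) : k ≤ 6 := by
  -- The path reaches the far in-port of an arm at the bottom early, as this in-port and its
  -- predecessor are adjacent to out-ports of `s`.
  have far_le : ∀ {a b : Bool} {j : ℕ}, j + 1 < n → f j = (t, far a b) →
      f (j + 1) = (t, conn a b) → j ≤ 4 := by
    intro a b j hj hfj hfj'
    have hj0 : j ≠ 0 := by rintro rfl; simp [h0] at hfj
    cases y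
    · have h1 := h.pred (i := j) (by omega) hj0
      rw [hfj] at h1
      rcases ht.adj_far hB h1 with h' | h' | h'
      · have := h.eq_one_of_adj (i := j - 1) (by omega)
          (by rw [h0, h']; exact ht.adj_inPort hB false a b)
        omega
      · have := h.inj _ _ (by omega) (by omega) (h'.trans hfj'.symm)
        omega
      · have := h.out_to_out hB hb h0 (by omega) h'
        omega
    · have := h.eq_one_of_adj (i := j) (by omega)
        (by rw [h0, hfj]; exact ht.adj_inPort hB true a b)
      omega
  have hk0 : k ≠ 0 := by rintro rfl; simp [h0] at hfk
  have h1 := h.pred hk hk0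
  rw [hfk] at h1
  rcases ht.adj_conn (hb _ (by omega)) h1 with h' | h'
  · have := far_le (by omega) h' (by rw [Nat.sub_add_cancel (by omega), hfk])
    omega
  · have hk1 : k - 1 ≠ 0 := fun h3 => by rw [h3, h0] at h'; simp at h'
    have h2 := h.pred (i := k - 1) (by omega) hk1
    rw [h'] at h2
    rcases ht.adj_conn (hb _ (by omega)) h2 with h4 | h4
    · have := far_le (by omega) h4 (by rw [Nat.sub_add_cancel (by omega), h'])
      omega
    · rw [Bool.not_not] at h4
      have := h.inj _ _ (by omega) (by omega) (h4.trans hfk.symm)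
      omega

/-- A path rooted at the root of a block stays in the block, or soon becomes a path rooted just
below the block. -/
theorem RootPath.leave_block (h : RootPath s f n) (hB : IsBlock ℓ m s.1.length) :
    (∀ i < n, InBlock m s (f i)) ∨ ∃ k ≤ 20, k < n ∧ ∃ t : Node ℓ,
      t.1.length = s.1.length + treeDepth m ∧ RootPath t (fun i => f (k + i)) (n - k) := by
  classical
  obtain ⟨y, h0⟩ := h.start
  by_cases hall : ∀ i < n, InBlock m s (f i)
  · exact .inl hall
  push Not at hall
  right
  have hk := Nat.find_spec hall
  have hmin : ∀ i < Nat.find hall, InBlock m s (f i) := fun i hi => by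
    have h1 := Nat.find_min hall hi
    push Not at h1
    exact h1 (hi.trans hk.1)
  generalize Nat.find hall = k at hk hmin
  obtain ⟨hkn, hks⟩ := hk
  have h3 := three_le_treeDepth m
  obtain ⟨k, rfl⟩ : ∃ k', k = k' + 1 := by
    refine Nat.exists_eq_succ_of_ne_zero ?_
    rintro rfl
    refine hks ⟨h.below 0 hkn, ?_⟩
    rw [h0]
    change s.1.length < _
    omega
  have hbk := h.below _ hkn
  have hlk : s.1.length + treeDepth m ≤ (f (k + 1)).1.1.length := by
    by_contra hlt
    exact hks ⟨hbk, by omega⟩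
  have hin := hmin k (by omega)
  have hadj := h.path.succ hkn
  obtain ⟨u, t, x, z, ht, hu, hw⟩ : ∃ (u t : Node ℓ) (x z : Bool), t.1 = x :: u.1 ∧
      f k = (u, conn x z) ∧ f (k + 1) = (t, out z) := by
    generalize f (k + 1) = w at *
    generalize f k = v at *
    have hlow : ∀ {r t : Node ℓ}, s.1 <:+ r.1 → r.1.length < s.1.length + treeDepth m →
        s.1.length + treeDepth m ≤ t.1.length → (r.depth, t.depth) ∉ nestedIntervals ℓ := by
      intro r t h1 h2 h3 hN
      have h4 := h1.length_le
      simp only [Node.depth] at hN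
      have := hB.right_le hN (by omega) (by omega)
      omega
    rcases hadj with ⟨-, hadj | hadj⟩
    · cases hadj with
      | gadget => exact absurd hin hks
      | tree u t x z ht => exact ⟨u, t, x, z, ht, rfl, rfl⟩
      | rib_left r t _ _ _ hN => exact absurd hN (hlow hin.1 hin.2 hlk)
      | rib_right r t _ _ _ hN => exact absurd hN (hlow hin.1 hin.2 hlk)
    · have h1 := hin.2
      cases hadj with
      | gadget => exact absurd hin hks
      | tree u t x z ht => simp only [ht, List.length_cons] at *; omega
      | rib_left r t _ _ hr _ => have := hr.length_lt; simp only at *; omega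
      | rib_right r t _ _ hr _ => have := hr.length_lt; simp only at *; omega
  have hl1 := hin.2
  rw [hu] at hl1
  rw [hw] at hlk
  simp only [ht, List.length_cons] at hl1 hlk
  have hbot : Bottom m s u := ⟨by have := hin.1; rwa [hu] at this, by omega⟩
  have hcross := (h.path.take hkn.le).cross_block hB hmin h0 (k := k) (by omega) hbot hu
  refine ⟨k + 1, by omega, hkn, t, by rw [ht, List.length_cons]; omega,
    h.path.no_return hkn hu hw ht fun r z' i j hi hj hit hr hfj hN => ?_⟩
  have hrs := (h.below j hj).length_le
  rw [hfj] at hrs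
  have hrt := hr.length_lt
  rw [ht, List.length_cons] at hrt
  have hle := hB.right_le hN (by simp only [Node.depth]; simp only at hrs; omega)
    (by simp only [Node.depth]; omega)
  have hit := hit.length_le
  rw [ht, List.length_cons] at hit
  simp only [Node.depth] at hle
  omega

end

/-! ### The bound for induced paths -/

section

variable {ℓ m M : ℕ} {s t : Node ℓ} {f : ℕ → Node ℓ × GadgetVertex} {n : ℕ}

/-- A rooted path that ends in a connector at the end of a cascade crosses every part of it. -/
theorem RootPath.length_le_of_cross {e k : ℕ} (hc : Cascade ℓ M s.1.length e k)
    (h : RootPath s f n) {u : Node ℓ} {x y : Bool} (hu : u.1.length + 1 = e)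
    (hf : f (n - 1) = (u, conn x y)) : n ≤ 20 * k := by
  generalize ha : s.1.length = a at hc
  induction hc generalizing s f n with
  | nil e =>
    have hpos := h.pos
    have := (h.below (n - 1) (by omega)).length_le
    rw [hf] at this
    simp only at this
    omega
  | plain hp _ ih =>
    obtain ⟨y', h0⟩ := h.start
    rcases h.path.leave_gadget h.below (by rw [h0])
      (fun z i b _ _ => by rw [Node.depth, ha]; exact hp b) with hn | ⟨k, hk, hkn, t, x', ht, hR⟩
    · omega
    · have := ih hR hu (by rw [← hf]; congr 1; omega) (by rw [ht, List.length_cons, ha])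
      omega
  | block hB _ hr ih =>
    subst ha
    rcases h.leave_block hB with hall | ⟨k, hk, hkn, t, ht, hR⟩
    · have hpos := h.pos
      have hin := hall (n - 1) (by omega)
      rw [hf] at hin
      have hl := hin.2
      have hle := hr.le
      simp only at hl
      obtain ⟨y', h0⟩ := h.start
      have := h.path.cross_block hB hall h0 (k := n - 1) (t := u) (by omega) ⟨hin.1, by omega⟩ hf
      omega
    · have := ih hR hu (by rw [← hf]; congr 1; omega) ht
      omega

/-- Bound for rooted paths that stay in a block of level `m`. The recursion in
`RootPath.length_le_of_inBlock` adds `80 * m + 124` from level `m` to level `m + 1`. -/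
def blockBound (m : ℕ) : ℕ := 124 * m ^ 2

theorem blockBound_mono {m M : ℕ} (h : m ≤ M) : blockBound m ≤ blockBound M := by
  unfold blockBound
  gcongr

/-- A rooted path in the region of a cascade crosses some of its parts, and then stays in one. -/
theorem RootPath.length_le_of_cascade {e k : ℕ}
    (hE : ∀ m ≤ M, ∀ (s : Node ℓ) (f : ℕ → Node ℓ × GadgetVertex) (n : ℕ),
      IsBlock ℓ m s.1.length → RootPath s f n → (∀ i < n, InBlock m s (f i)) → n ≤ blockBound m)
    (hc : Cascade ℓ M s.1.length e k) (h : RootPath s f n)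
    (hf : ∀ i < n, (f i).1.1.length < e) : n ≤ 20 * k + blockBound M := by
  generalize ha : s.1.length = a at hc
  induction hc generalizing s f n with
  | nil e =>
    have := hf 0 h.pos
    have := (h.below 0 h.pos).length_le
    omega
  | plain hp _ ih =>
    obtain ⟨y', h0⟩ := h.start
    rcases h.path.leave_gadget h.below (by rw [h0])
      (fun z i b _ _ => by rw [Node.depth, ha]; exact hp b) with hn | ⟨k, hk, hkn, t, x', ht, hR⟩
    · omega
    · have := ih hR (fun i hi => hf _ (by omega)) (by rw [ht, List.length_cons, ha])
      omega
  | block hB hm hr ih =>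
    subst ha
    rcases h.leave_block hB with hall | ⟨k, hk, hkn, t, ht, hR⟩
    · have := hE _ hm s f n hB h hall
      have := blockBound_mono hm
      omega
    · have := ih hR (fun i hi => hf _ (by omega)) ht
      omega

/-- Up to at most 20 vertices at its start, the path `f 0, …, f (n - 1)` is empty, or rooted at a
child of `w`, or rooted at `w` itself; the latter only if `f` visits an out-port of `w`. -/
def RootTail (w : Node ℓ) (f : ℕ → Node ℓ × GadgetVertex) (n : ℕ) : Prop :=
  n ≤ 20 ∨ ∃ k ≤ 20, k < n ∧ ∃ t : Node ℓ, RootPath t (fun i => f (k + i)) (n - k) ∧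
    ((t = w ∧ ∃ i < n, ∃ y, f i = (w, out y)) ∨ t.1.length = w.1.length + 1)

theorem IndPath.rootTail (h : IndPath (ribbedTree ℓ) f n) (hn : 0 < n) (hb : ∀ i < n, Below s (f i))
    (h0 : (∃ y, f 0 = (s, out y)) ∨ ((f 0).1 = s ∧ ∀ i < n, ∀ y, f i ≠ (s, out y))) :
    RootTail s f n := by
  rcases h0 with ⟨y, h0⟩ | ⟨h0, hno⟩
  · refine .inr ⟨0, by omega, hn, s, ?_, .inl ⟨rfl, 0, hn, y, h0⟩⟩
    simp only [zero_add]
    exact ⟨h, by omega, ⟨y, h0⟩, hb⟩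
  · rcases h.leave_gadget hb h0 (fun z i b hi hf => absurd hf (hno i hi z)) with
      hn | ⟨k, hk, hkn, t, x, ht, hR⟩
    · exact .inl hn
    · exact .inr ⟨k, hk, hkn, t, hR, .inr (by rw [ht, List.length_cons])⟩

/-- An induced path splits at a vertex of its top node `w` into two paths each of which, up to a few
vertices, is a rooted path. -/
theorem IndPath.exists_split (h : IndPath (ribbedTree ℓ) f n) (hn : 0 < n) :
    ∃ (w : Node ℓ) (i : ℕ), i < n ∧ (f i).1 = w ∧ (∀ j < n, Below w (f j)) ∧
      RootTail w (fun j => f (i + j)) (n - i) ∧ RootTail w (fun j => f (i - j)) (i + 1) := by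
  obtain ⟨w, ⟨i₀, hi₀, hw⟩, hb⟩ := h.exists_top hn
  obtain ⟨i, hi, hwi, h0⟩ : ∃ i < n, (f i).1 = w ∧ ((∃ y, f i = (w, out y)) ∨
      ∀ j < n, ∀ y, f j ≠ (w, out y)) := by
    by_cases hout : ∃ i < n, ∃ y, f i = (w, out y)
    · obtain ⟨i, hi, y, hy⟩ := hout
      exact ⟨i, hi, by rw [hy], .inl ⟨y, hy⟩⟩
    · push Not at hout
      exact ⟨i₀, hi₀, hw, .inr hout⟩
  refine ⟨w, i, hi, hwi, hb, ?_, ?_⟩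
  · refine (h.sub (by omega)).rootTail (by omega) (fun j _ => hb _ (by omega)) ?_
    exact h0.imp id fun h' => ⟨hwi, fun j _ => h' _ (by omega)⟩
  · refine (h.rev hi).rootTail (by omega) (fun j _ => hb _ (by omega)) ?_
    exact h0.imp id fun h' => ⟨hwi, fun j _ => h' _ (by omega)⟩

/-- A path inside a block that starts at the parent of a bottom node and avoids the out-ports of the
root: up to its top node it crosses the parts of a cascade, and then it is a rooted path. -/
theorem IndPath.length_le_of_climb (h : IndPath (ribbedTree ℓ) f n) (hn : 0 < n)
    (hE : ∀ m' ≤ m, ∀ (s : Node ℓ) (f : ℕ → Node ℓ × GadgetVertex) (n : ℕ),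
      IsBlock ℓ m' s.1.length → RootPath s f n → (∀ i < n, InBlock m' s (f i)) → n ≤ blockBound m')
    (hB : IsBlock ℓ (m + 1) s.1.length) (hb : ∀ i < n, InBlock (m + 1) s (f i))
    (hno : ∀ i < n, ∀ y, f i ≠ (s, out y)) {u : Node ℓ} {x z : Bool}
    (hu : u.1.length + 2 = s.1.length + treeDepth (m + 1)) (h0 : f 0 = (u, conn x z)) :
    n ≤ 80 * m + 100 + blockBound m := by
  have hd := three_le_treeDepth (m + 1)
  obtain ⟨w, i, hi, hwi, hbw, h1, h2⟩ := h.exists_split hn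
  have hws : s.1 <:+ w.1 := hwi ▸ (hb i hi).1
  -- A rooted part starts strictly below `s`, because the path avoids the out-ports of `s`.
  have hdepth : ∀ {g : ℕ → Node ℓ × GadgetVertex} {l : ℕ} {t : Node ℓ},
      (∀ j < l, ∃ j' < n, g j = f j') → ∀ {k}, RootPath t (fun i => g (k + i)) (l - k) → k < l →
      ((t = w ∧ ∃ i < l, ∃ y, g i = (w, out y)) ∨ t.1.length = w.1.length + 1) →
      s.1.length < t.1.length ∧ t.1.length < s.1.length + treeDepth (m + 1) := by
    intro g l t hg k hR hk ht
    constructor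
    · have hle := hws.length_le
      rcases ht with ⟨rfl, j, hj, y, hy⟩ | ht
      · refine lt_of_le_of_ne hle fun heq => ?_
        have hst := Subtype.ext (hws.eq_of_length heq)
        obtain ⟨j', hj', hgj⟩ := hg j hj
        exact hno j' hj' y (by rw [← hgj, hy, hst])
      · omega
    · obtain ⟨y, hy⟩ := hR.start
      obtain ⟨j', hj', hgj⟩ := hg (k + 0) (by omega)
      have := (hb j' hj').2
      rw [← hgj, hy] at this
      exact this
  -- The part after the top vertex is, up to a few vertices, a rooted path in the block.
  have hpart1 : n - i ≤ 20 + 20 * (2 * m + 2) + blockBound m := by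
    rcases h1 with h1 | ⟨k, hk, hkn, t, hR, ht⟩
    · omega
    · obtain ⟨ht1, ht2⟩ := hdepth (fun j hj => ⟨i + j, by omega, rfl⟩) hR hkn ht
      clear ht
      obtain ⟨c, hc, hcas⟩ := hB.cascade ht1 ht2
      have := hR.length_le_of_cascade hE (hcas.append hB.cascade_last)
        (fun j hj => (hb _ (by omega)).2)
      omega
  -- The reversed part before the top vertex ends at `u`, just above the bottom of the block.
  have hpart2 : i + 1 ≤ 20 + 20 * (2 * m + 1) := by
    rcases h2 with h2 | ⟨k, hk, hkn, t, hR, ht⟩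
    · omega
    · obtain ⟨ht1, ht2⟩ := hdepth (fun j hj => ⟨i - j, by omega, rfl⟩) hR hkn ht
      clear ht
      obtain ⟨c, hc, hcas⟩ := hB.cascade ht1 ht2
      have := hR.length_le_of_cross hcas (u := u) (x := x) (y := z) (by omega)
        (by rw [← h0]; exact congrArg f (by omega))
      omega
  omega

/-- A rooted path that stays in a block of level `m` has order `O(m²)`: after its last out-port of
the root it enters the part of the block between the first and the last depth for good, and a
further long detour is only possible in a block of lower level. -/
theorem RootPath.length_le_of_inBlock {m : ℕ} (hB : IsBlock ℓ m s.1.length) (h : RootPath s f n)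
    (hb : ∀ i < n, InBlock m s (f i)) : n ≤ blockBound m := by
  classical
  induction m using Nat.strong_induction_on generalizing s f n with
  | h m ih =>
  obtain ⟨m, rfl⟩ := Nat.exists_eq_add_of_le' hB.1
  have hE : ∀ m' ≤ m, ∀ (s : Node ℓ) (f : ℕ → Node ℓ × GadgetVertex) (n : ℕ),
      IsBlock ℓ m' s.1.length → RootPath s f n → (∀ i < n, InBlock m' s (f i)) →
      n ≤ blockBound m' := fun m' hm' s f n h1 h2 h3 => ih m' (by omega) h1 h2 h3
  suffices hn : n ≤ 80 * m + 124 + blockBound m by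
    refine hn.trans ?_
    unfold blockBound
    nlinarith
  have hd := three_le_treeDepth (m + 1)
  obtain ⟨y, h0⟩ := h.start
  have hpos := h.pos
  obtain ⟨k, z, hkn, hk, hlast⟩ : ∃ k z, k < n ∧ f k = (s, out z) ∧
      ∀ j, k < j → j < n → ∀ y, f j ≠ (s, out y) := by
    have hsp := Nat.findGreatest_spec (P := fun k => ∃ y, f k = (s, out y)) (n := n - 1)
      (Nat.zero_le _) ⟨y, h0⟩
    have hle := Nat.findGreatest_le (P := fun k => ∃ y, f k = (s, out y)) (n - 1)
    obtain ⟨z, hz⟩ := hsp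
    exact ⟨_, z, by omega, hz, fun j hj hjn y hy =>
      Nat.findGreatest_is_greatest hj (by omega) ⟨y, hy⟩⟩
  -- From here on, `k` is the last index of an out-port of `s`.
  have hk3 := h.path.out_to_out hB hb h0 hkn hk
  rcases Nat.lt_or_ge (k + 1) n with hkn1 | hkn1
  swap
  · omega
  have hadj := h.path.succ hkn1
  have hg := h.path.sub (a := k + 1) (m := n - (k + 1)) (by omega)
  rw [hk] at hadj
  rcases adj_block_root hB (hb _ hkn1).1 hadj with ⟨x, hx⟩ | ⟨t, a, b, ht, hx⟩
  · rcases hg.leave_gadget (s := s) (fun i hi => (hb _ (by omega)).1) (by simp [hx])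
      (fun z i b hi hf => absurd hf (hlast _ (by omega) (by omega) z)) with
      hn | ⟨k', hk', hkn', t, x', ht, hR⟩
    · omega
    · have htl : t.1.length = s.1.length + 1 := by rw [ht, List.length_cons]
      obtain ⟨c, hc, hcas⟩ := hB.cascade (a := t.1.length) (by omega) (by omega)
      have := hR.length_le_of_cascade hE (hcas.append hB.cascade_last)
        (fun j hj => (hb _ (by omega)).2)
      omega
  · -- The path jumps to a bottom node `t`, whose gadget it can leave only to the parent of `t`.
    rcases hg.first_exit (s := t) (by simp [hx]) with hn | ⟨k', hk', hkn', hft, hfe⟩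
    · omega
    obtain ⟨u, x, y', hu, hfu⟩ : ∃ (u : Node ℓ) (x y : Bool), t.1 = x :: u.1 ∧
        f (k + 1 + (k' + 1)) = (u, conn x y) := by
      have hin := hb (k + 1 + (k' + 1)) (by omega)
      have hno := hlast (k + 1 + (k' + 1)) (by omega) (by omega)
      have hadj' := hg.succ (i := k') (by omega)
      obtain ⟨g, hg'⟩ : ∃ g, f (k + 1 + k') = (t, g) := ⟨_, Prod.ext hft rfl⟩
      simp only [hg'] at hadj'
      have hnb : ¬ Below t (f (k + 1 + (k' + 1))) := by
        intro hbt
        refine hfe (hbt.node_eq ?_)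
        have := hin.2
        have := ht.2
        omega
      rcases boundary (t := t) (v := (t, g)) List.suffix_rfl hnb hadj' with
        ⟨u, x, y', hu, -, h2⟩ | ⟨r, y', hr, hN, h2⟩
      · exact ⟨u, x, y', hu, h2⟩
      · obtain rfl := ht.origin_eq hB hr hN
        exact absurd h2 (hno y')
    have hul : u.1.length + 2 = s.1.length + treeDepth (m + 1) := by
      have := ht.2
      rw [hu, List.length_cons] at this
      omega
    have := (h.path.sub (a := k + 1 + (k' + 1)) (m := n - (k + 1 + (k' + 1)))
      (by omega)).length_le_of_climb (by omega) hE hB (fun i hi => hb _ (by omega))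
      (fun i hi y => hlast _ (by omega) (by omega) y) hul hfu
    omega

theorem IndPath.length_le (hℓ : 1 ≤ ℓ) (h : IndPath (ribbedTree ℓ) f n) : n ≤ 1000 * ℓ ^ 2 := by
  rcases Nat.eq_zero_or_pos n with rfl | hn
  · omega
  have hlen : ∀ {g : ℕ → Node ℓ × GadgetVertex} {l : ℕ} {w : Node ℓ}, RootTail w g l →
      l ≤ 20 + 20 * (2 * ℓ + 2) + blockBound ℓ := by
    rintro g l w (hl | ⟨k, hk, hkl, t, hR, -⟩)
    · omega
    · obtain ⟨c, hc, hcas⟩ : ∃ c ≤ 2 * ℓ + 2, Cascade ℓ ℓ t.1.length (treeDepth ℓ) c := by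
        have hB := isBlock_self hℓ
        rcases Nat.eq_zero_or_pos t.1.length with h0 | h0
        · rw [h0]
          exact ⟨1, by omega, .block hB le_rfl (by rw [zero_add]; exact .nil _)⟩
        · have hlast := hB.cascade_last (M := ℓ)
          have hcas := @IsBlock.cascade ℓ (ℓ - 1) 0
          rw [Nat.sub_add_cancel hℓ] at hcas
          obtain ⟨c, hc, hcas⟩ := hcas hB h0 (by have := t.2; omega)
          refine ⟨c + 1, by omega, ?_⟩
          have := (hcas.mono (Nat.sub_le ℓ 1)).append hlast
          rwa [zero_add] at this
      have := hR.length_le_of_cascade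
        (fun m hm s f n hB h hb => h.length_le_of_inBlock hB hb) hcas (fun i _ => (g (k + i)).1.2)
      omega
  obtain ⟨w, i, hi, -, -, h1, h2⟩ := h.exists_split hn
  have h1' := hlen h1
  have h2' := hlen h2
  clear h1 h2
  have : blockBound ℓ = 124 * ℓ ^ 2 := rfl
  have : ℓ ≤ ℓ ^ 2 := Nat.le_self_pow (by omega) ℓ
  omega

/-- Induced paths of `G_ℓ` have order `O(ℓ²)`. -/
theorem inducedPath_le (hℓ : 1 ≤ ℓ) {q : ℕ} (h : pathGraph q ⊴ ribbedTree ℓ) :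
    q ≤ 1000 * ℓ ^ 2 := by
  obtain ⟨e⟩ := h
  rcases Nat.eq_zero_or_pos q with rfl | hq
  · omega
  refine IndPath.length_le (f := fun i => if h : i < q then e ⟨i, h⟩ else e ⟨0, hq⟩) hℓ
    ⟨fun i j hi hj hij => ?_, fun i j hi hj => ?_⟩
  · simpa [hi, hj] using hij
  · simp [hi, hj, pathGraph_adj]

end

/-! ### Closure properties of constellations -/

section

theorem isStarOn_singleton {V : Type} (H : SimpleGraph V) (v : V) : IsStarOn H v {v} := by
  refine ⟨rfl, ?_⟩
  rintro u rfl w rfl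
  simp

variable {V : Type} [LinearOrder V] {H : SimpleGraph V} {A : Set V}

theorem isConstellationOn_singleton (H : SimpleGraph V) (v : V) : IsConstellationOn H {v} := by
  have := IsConstellationOn.first (H := H) v {v} ∅ (by simp) (isStarOn_singleton H v)
    (by simp [NoEdgesBetween]) (by simp) .empty
  simpa using this

/-- A vertex below all others may be added if it is isolated. -/
theorem IsConstellationOn.insert_first (h : IsConstellationOn H A) {v : V} (hv : ∀ a ∈ A, v < a)
    (hadj : ∀ a ∈ A, ¬ H.Adj v a) : IsConstellationOn H (insert v A) := by
  rw [Set.insert_eq]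
  exact .concat {v} A (by simpa using hv) (by simpa [NoEdgesBetween] using hadj)
    (isConstellationOn_singleton H v) h

theorem IsConstellationOn.insert_last (h : IsConstellationOn H A) {v : V} (hv : ∀ a ∈ A, a < v)
    (hadj : ∀ a ∈ A, ¬ H.Adj v a) : IsConstellationOn H (insert v A) := by
  rw [Set.insert_eq, Set.union_comm]
  refine .concat A {v} (by simpa using hv) ?_ h (isConstellationOn_singleton H v)
  rintro u hu _ rfl huv
  exact hadj u hu huv.symm

theorem IsConstellationOn.insert_isolated (h : IsConstellationOn H A) {v : V}
    (hadj : ∀ a ∈ A, ¬ H.Adj v a) : IsConstellationOn H (insert v A) := by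
  induction h with
  | empty => exact IsConstellationOn.empty.insert_first (by simp) (by simp)
  | first c S T hST hS hsep hc hT ih =>
    by_cases hvA : v ∈ S ∪ T
    · rw [Set.insert_eq_of_mem hvA]; exact .first c S T hST hS hsep hc hT
    rcases le_or_gt c v with hcv | hcv
    · rw [← Set.union_insert]
      refine .first c S _ ?_ hS ?_ ?_ (ih fun a ha => hadj a (.inr ha))
      · rw [Set.disjoint_insert_right]
        exact ⟨fun h => hvA (.inl h), hST⟩
      · rintro u hu w (rfl | hw) huw
        exacts [hadj u (.inl hu) huw.symm, hsep u hu w hw huw]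
      · rintro w (hw | rfl | hw)
        exacts [hc w (.inl hw), hcv, hc w (.inr hw)]
    · exact (IsConstellationOn.first c S T hST hS hsep hc hT).insert_first
        (fun a ha => hcv.trans_le (hc a ha)) hadj
  | last c S T hST hS hsep hc hT ih =>
    by_cases hvA : v ∈ S ∪ T
    · rw [Set.insert_eq_of_mem hvA]; exact .last c S T hST hS hsep hc hT
    rcases le_or_gt v c with hcv | hcv
    · rw [← Set.union_insert]
      refine .last c S _ ?_ hS ?_ ?_ (ih fun a ha => hadj a (.inr ha))
      · rw [Set.disjoint_insert_right]
        exact ⟨fun h => hvA (.inl h), hST⟩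
      · rintro u hu w (rfl | hw) huw
        exacts [hadj u (.inl hu) huw.symm, hsep u hu w hw huw]
      · rintro w (hw | rfl | hw)
        exacts [hc w (.inl hw), hcv, hc w (.inr hw)]
    · exact (IsConstellationOn.last c S T hST hS hsep hc hT).insert_last
        (fun a ha => (hc a ha).trans_lt hcv) hadj
  | concat A B hlt hsep hA hB ihA ihB =>
    by_cases hvB : ∃ b ∈ B, b ≤ v
    · obtain ⟨b, hb, hbv⟩ := hvB
      rw [← Set.union_insert]
      refine .concat A _ ?_ ?_ hA (ihB fun a ha => hadj a (.inr ha))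
      · rintro a ha w (rfl | hw)
        exacts [(hlt a ha b hb).trans_le hbv, hlt a ha w hw]
      · rintro u hu w (rfl | hw) huw
        exacts [hadj u (.inl hu) huw.symm, hsep u hu w hw huw]
    · push Not at hvB
      rw [← Set.insert_union]
      refine .concat _ B ?_ ?_ (ihA fun a ha => hadj a (.inl ha)) hB
      · rintro a (rfl | ha) w hw
        exacts [hvB w hw, hlt a ha w hw]
      · rintro u (rfl | hu) w hw huw
        exacts [hadj w (.inr hw) huw, hsep u hu w hw huw]

theorem IsConstellationOn.union_isolated (h : IsConstellationOn H A) {I : Set V} (hI : I.Finite)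
    (hadj : ∀ v ∈ I, ∀ a ∈ A ∪ I, ¬ H.Adj v a) : IsConstellationOn H (A ∪ I) := by
  induction I, hI using Set.Finite.induction_on with
  | empty => simpa using h
  | @insert v I hv _ ih =>
    rw [Set.union_insert]
    refine (ih fun u hu a ha => hadj u (.inr hu) a ?_).insert_isolated fun a ha =>
      hadj v (.inl rfl) a ?_
    all_goals
      rcases ha with ha | ha
      exacts [.inl ha, .inr (.inr ha)]

/-- Addition of a star whose center is the first or the last vertex, and of isolated vertices, to a
constellation `T`. -/
theorem IsConstellationOn.add_star [Finite V] {T : Set V} {c : V} (hcA : c ∈ A)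
    (hext : (∀ v ∈ A, c ≤ v) ∨ ∀ v ∈ A, v ≤ c) (hTA : T ⊆ A) (hcT : c ∉ T)
    (hTc : ∀ v ∈ T, ¬ H.Adj c v)
    (hT : ∀ v ∈ A, v ∉ T → v ≠ c → ∀ w ∈ A, H.Adj v w → w = c)
    (h : IsConstellationOn H T) : IsConstellationOn H A := by
  set S : Set V := insert c {v | v ∈ A ∧ H.Adj c v} with hS
  set I : Set V := {v | v ∈ A ∧ v ∉ T ∧ v ≠ c ∧ ¬ H.Adj c v} with hI
  have hSA : S ⊆ A := Set.insert_subset hcA fun v hv => hv.1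
  have hTI : IsConstellationOn H (T ∪ I) := by
    refine h.union_isolated (Set.toFinite I) ?_
    rintro v ⟨hvA, hvT, hvc, hcv⟩ a ha hva
    have := hT v hvA hvT hvc a (ha.elim (fun h => hTA h) fun h => h.1) hva
    exact hcv (this ▸ hva.symm)
  have hTIA : T ∪ I ⊆ A := Set.union_subset hTA fun v hv => hv.1
  have hTIc : ∀ v ∈ T ∪ I, v ≠ c ∧ ¬ H.Adj c v := by
    rintro v (hv | hv)
    exacts [⟨fun h => hcT (h ▸ hv), hTc v hv⟩, hv.2.2]
  have hST : Disjoint S (T ∪ I) := by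
    rw [Set.disjoint_left]
    rintro v (rfl | hv) hv'
    exacts [(hTIc v hv').1 rfl, (hTIc v hv').2 hv.2]
  have hleaf : ∀ v ∈ A, H.Adj c v → ∀ w ∈ A, H.Adj v w → w = c := fun v hv hcv =>
    hT v hv (fun h => hTc v h hcv) hcv.ne'
  have hstar : IsStarOn H c S := by
    refine ⟨.inl rfl, ?_⟩
    intro u hu v hv
    constructor
    · refine fun huv => ⟨huv.ne, ?_⟩
      rcases hu with rfl | hu
      · exact .inl rfl
      · exact .inr (hleaf u hu.1 hu.2 v (hSA hv) huv)
    · rintro ⟨hne, rfl | rfl⟩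
      · rcases hv with rfl | hv
        exacts [absurd rfl hne, hv.2]
      · rcases hu with rfl | hu
        exacts [absurd rfl hne, hu.2.symm]
  have hsep : NoEdgesBetween H S (T ∪ I) := by
    rintro u (rfl | hu) v hv huv
    · exact (hTIc v hv).2 huv
    · exact (hTIc v hv).1 (hleaf u hu.1 hu.2 v (hTIA hv) huv)
  have hA : A = S ∪ (T ∪ I) := by
    refine Set.Subset.antisymm (fun v hv => ?_) (Set.union_subset hSA hTIA)
    by_cases hvc : v = c
    · exact .inl (.inl hvc)
    by_cases hcv : H.Adj c v
    · exact .inl (.inr ⟨hv, hcv⟩)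
    by_cases hvT : v ∈ T
    · exact .inr (.inl hvT)
    · exact .inr (.inr ⟨hv, hvT, hvc, hcv⟩)
  rcases hext with hext | hext
  · rw [hA] at hext ⊢
    exact .first c S _ hST hstar hsep hext hTI
  · rw [hA] at hext ⊢
    exact .last c S _ hST hstar hsep hext hTI

/-- Ordered subgraphs of constellations are constellations. -/
theorem IsConstellationOn.of_embedding {W : Type} [LinearOrder W] [Finite W] {K : SimpleGraph W}
    (h : IsConstellationOn H A) (a : W ↪o V) (ha : ∀ i j, K.Adj i j → H.Adj (a i) (a j))
    {B : Set W} (hB : ∀ b ∈ B, a b ∈ A) : IsConstellationOn K B := by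
  have star : ∀ {c : V} {S T : Set V}, IsStarOn H c S → NoEdgesBetween H S T →
      ((∀ v ∈ S ∪ T, c ≤ v) ∨ ∀ v ∈ S ∪ T, v ≤ c) → Disjoint S T →
      (∀ {B : Set W}, (∀ b ∈ B, a b ∈ T) → IsConstellationOn K B) →
      ∀ {B : Set W}, (∀ b ∈ B, a b ∈ S ∪ T) → IsConstellationOn K B := by
    intro c S T hS hsep hext hST ih B hB
    have hT : IsConstellationOn K {b ∈ B | a b ∈ T} := ih fun b hb => hb.2
    have hedge : ∀ v ∈ B, a v ∉ T → a v ≠ c → ∀ w ∈ B, K.Adj v w → a w = c := by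
      intro v hv hvT hvc w hw hvw
      have hvS := (hB v hv).resolve_right hvT
      have hwS := (hB w hw).resolve_right fun hwT => hsep _ hvS _ hwT (ha _ _ hvw)
      exact (((hS.2 _ hvS _ hwS).1 (ha _ _ hvw)).2).resolve_left hvc
    by_cases hc : ∃ b ∈ B, a b = c
    · obtain ⟨b, hb, rfl⟩ := hc
      refine hT.add_star (c := b) hb ?_ (fun v hv => hv.1)
        (fun h => Set.disjoint_left.1 hST hS.1 h.2)
        (fun v hv hbv => hsep _ hS.1 _ hv.2 (ha _ _ hbv))
        fun v hv hvT hvb w hw hvw => a.injective (hedge v hv (fun h => hvT (by exact ⟨hv, h⟩))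
          (fun h => hvb (a.injective h)) w hw hvw)
      exact hext.imp (fun h v hv => a.le_iff_le.1 (h _ (hB v hv)))
        fun h v hv => a.le_iff_le.1 (h _ (hB v hv))
    · push Not at hc
      have hBT : B = {b ∈ B | a b ∈ T} ∪ {b ∈ B | a b ∉ T} := by
        ext b
        by_cases a b ∈ T <;> simp_all
      rw [hBT]
      refine hT.union_isolated (Set.toFinite _) ?_
      rintro v ⟨hv, hvT⟩ w hw hvw
      rw [← hBT] at hw
      exact hc w hw (hedge v hv hvT (hc v hv) w hw hvw)
  induction h generalizing B with
  | empty =>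
    obtain rfl : B = ∅ := Set.eq_empty_of_forall_notMem hB
    exact .empty
  | first c S T hST hS hsep hc hT ih => exact star hS hsep (.inl hc) hST (fun h => ih h) hB
  | last c S T hST hS hsep hc hT ih => exact star hS hsep (.inr hc) hST (fun h => ih h) hB
  | concat A₁ A₂ hlt hsep _ _ ih₁ ih₂ =>
    have hBA : B = {b ∈ B | a b ∈ A₁} ∪ {b ∈ B | a b ∈ A₂} := by
      ext b
      have := hB b
      simp only [Set.mem_union, Set.mem_ofPred_eq] at *
      tauto
    rw [hBA]
    exact .concat _ _ (fun u hu v hv => a.lt_iff_lt.1 (hlt _ hu.2 _ hv.2))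
      (fun u hu v hv huv => hsep _ hu.2 _ hv.2 (ha _ _ huv)) (ih₁ fun b hb => hb.2)
      (ih₂ fun b hb => hb.2)

theorem IsConstellationOn.subset [Finite V] (h : IsConstellationOn H A) {B : Set V} (hB : B ⊆ A) :
    IsConstellationOn H B :=
  h.of_embedding (RelEmbedding.refl _) (fun _ _ h => h) hB

theorem IsConstellation.of_containsOrdered {k n : ℕ} {G : SimpleGraph (Fin n)}
    {H : SimpleGraph (Fin k)} (hG : IsConstellation G) (h : ContainsOrdered G H) :
    IsConstellation H := by
  obtain ⟨a, ha⟩ := h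
  exact IsConstellationOn.of_embedding hG a ha fun _ _ => Set.mem_univ _

end

/-! ### The traversal of a subtree -/

section

variable {ℓ : ℕ}

/-- The child of `s` on the side `x`; if `s` is a leaf, the value is `s` itself. -/
def Node.child (x : Bool) (s : Node ℓ) : Node ℓ :=
  if h : s.1.length + 1 < treeDepth ℓ then ⟨x :: s.1, h⟩ else s

theorem Node.child_val {x : Bool} {s : Node ℓ} (h : s.1.length + 1 < treeDepth ℓ) :
    (s.child x).1 = x :: s.1 := by
  simp [child, h]

/-- The traversal of the subtree with `k` levels rooted at `s`, from the left to the right out-port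
of `s`. It visits the arms of `s` from left to right, and it visits the left subtree between the two
left connectors and the right subtree between the two right connectors. -/
def traversal : ℕ → Node ℓ → List (Node ℓ × GadgetVertex)
  | 0, _ => []
  | k + 1, s =>
    [(s, out false), (s, base false), (s, near false false), (s, far false false),
      (s, conn false false)] ++ (traversal k (s.child false) ++
    ([(s, conn false true), (s, far false true), (s, near false true), (s, near true false),
      (s, far true false), (s, conn true false)] ++ (traversal k (s.child true) ++
    [(s, conn true true), (s, far true true), (s, near true true), (s, base true), (s, out true)])))

theorem length_traversal (k : ℕ) (s : Node ℓ) : (traversal k s).length + 16 = 16 * 2 ^ k := by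
  induction k generalizing s with
  | zero => rfl
  | succ k ih =>
    have h1 := ih (s.child false)
    have h2 := ih (s.child true)
    simp only [traversal, List.length_append, List.length_cons, List.length_nil, pow_succ]
    omega

theorem suffix_iff_eq_or_cons {l m : List Bool} :
    l <:+ m ↔ m = l ∨ ∃ x, (x :: l) <:+ m := by
  constructor
  · rintro ⟨p, rfl⟩
    rcases List.eq_nil_or_concat p with rfl | ⟨p, x, rfl⟩
    · exact .inl rfl
    · exact .inr ⟨x, p, by simp⟩
  · rintro (rfl | ⟨x, h⟩)
    · exact List.suffix_rfl
    · exact (List.suffix_cons x l).trans h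

theorem mem_traversal_leaf_or {k : ℕ} {s : Node ℓ} (hs : s.1.length + (k + 1) = treeDepth ℓ)
    (ih : ∀ t : Node ℓ, t.1.length + k = treeDepth ℓ → ∀ v, v ∈ traversal k t ↔ Below t v)
    (x : Bool) (v : Node ℓ × GadgetVertex) :
    v ∈ traversal k (s.child x) ↔ (x :: s.1) <:+ v.1.1 := by
  rcases Nat.eq_zero_or_pos k with rfl | hk
  · simp only [traversal, List.not_mem_nil, false_iff]
    intro h
    have := h.length_le
    have := v.1.2
    simp only [List.length_cons] at *
    omega
  · have hc := s.child_val (x := x) (by omega)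
    rw [ih _ (by rw [hc, List.length_cons]; omega), Below, hc]

theorem mem_traversal {k : ℕ} {s : Node ℓ} (hs : s.1.length + k = treeDepth ℓ)
    (v : Node ℓ × GadgetVertex) : v ∈ traversal k s ↔ Below s v := by
  induction k generalizing s v with
  | zero => have := s.2; omega
  | succ k ih =>
    have hc := mem_traversal_leaf_or hs (fun t ht v => ih ht v)
    rw [Below, suffix_iff_eq_or_cons]
    simp only [traversal, List.mem_append, hc, Bool.exists_bool]
    obtain ⟨t, g⟩ := v
    by_cases hts : t = s
    · subst hts
      rcases g with (_ | _) | (_ | _) | ⟨_ | _, _ | _⟩ | ⟨_ | _, _ | _⟩ | ⟨_ | _, _ | _⟩ <;> simp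
    · have : t.1 ≠ s.1 := fun h => hts (Subtype.ext h)
      simp [hts, this]

theorem mem_traversal_child {k : ℕ} {s : Node ℓ} (hs : s.1.length + (k + 1) = treeDepth ℓ)
    (x : Bool) (v : Node ℓ × GadgetVertex) :
    v ∈ traversal k (s.child x) ↔ (x :: s.1) <:+ v.1.1 :=
  mem_traversal_leaf_or hs (fun _ ht v => mem_traversal ht v) x v

theorem not_cons_suffix (x : Bool) (l : List Bool) : ¬ (x :: l) <:+ l := by
  intro h
  have := h.length_le
  simp at this

theorem cons_suffix_unique {x y : Bool} {l m : List Bool} (h : (x :: l) <:+ m)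
    (h' : (y :: l) <:+ m) : x = y := by
  have := (List.suffix_of_suffix_length_le h h' (by simp)).eq_of_length (by simp)
  exact (List.cons_eq_cons.1 this).1

theorem nodup_traversal {k : ℕ} {s : Node ℓ} (hs : s.1.length + k = treeDepth ℓ) :
    (traversal k s).Nodup := by
  induction k generalizing s with
  | zero => exact List.nodup_nil
  | succ k ih =>
    have hc := mem_traversal_child hs
    have hn : ∀ x, (traversal k (s.child x)).Nodup := by
      intro x
      rcases Nat.eq_zero_or_pos k with rfl | hk
      · exact List.nodup_nil
      · exact ih (by rw [s.child_val (by omega), List.length_cons]; omega)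
    have hd : ∀ t : Node ℓ, (false :: s.1) <:+ t.1 → ¬ (true :: s.1) <:+ t.1 := fun t h h' => by
      simpa using cons_suffix_unique h h'
    simp only [traversal, List.nodup_append, hn]
    simp only [List.mem_append, hc, List.mem_cons, List.not_mem_nil, or_false]
    refine ⟨by simp, ⟨trivial, ⟨by simp, ⟨trivial, by simp, ?_⟩, ?_⟩, ?_⟩, ?_⟩
    all_goals
      rintro ⟨t, g⟩ ha _ hb rfl
      revert ha hb
      by_cases hts : t = s
      · rcases g with (_ | _) | (_ | _) | ⟨_ | _, _ | _⟩ | ⟨_ | _, _ | _⟩ | ⟨_ | _, _ | _⟩ <;>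
          simp [hts, not_cons_suffix]
      · simp [hts] <;> exact hd t

theorem head_traversal (k : ℕ) (s : Node ℓ) :
    (traversal (k + 1) s).head? = some (s, out false) := rfl

theorem getLast_traversal (k : ℕ) (s : Node ℓ) :
    (traversal (k + 1) s).getLast? = some (s, out true) := by
  rw [traversal]
  simp only [List.getLast?_append]
  rfl

theorem isChain_traversal {k : ℕ} {s : Node ℓ} (hs : s.1.length + k = treeDepth ℓ) :
    (traversal k s).IsChain (ribbedTree ℓ).Adj := by
  have e : ∀ {s : Node ℓ} {u v : GadgetVertex}, GadgetEdge u v → (ribbedTree ℓ).Adj (s, u) (s, v) ∧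
    (ribbedTree ℓ).Adj (s, v) (s, u) := fun h =>
    ⟨adj_of_gadgetEdge _ h, (adj_of_gadgetEdge _ h).symm⟩
  induction k generalizing s with
  | zero => exact .nil
  | succ k ih =>
    rcases k with _ | k
    · simp [traversal, e (.out_base _ _), e (.base_near _), e (.near_far _ _), e (.far_conn _ _),
        e (.conn_conn _), e .near_near]
    · have hc : ∀ x, (s.child x).1 = x :: s.1 := fun x => s.child_val (by omega)
      have hn : ∀ x, (traversal (k + 1) (s.child x)).IsChain (ribbedTree ℓ).Adj := fun x =>
        ih (by rw [hc, List.length_cons]; omega)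
      have hT : ∀ x, ((s, conn x false) :: (traversal (k + 1) (s.child x) ++
          [(s, conn x true)])).IsChain (ribbedTree ℓ).Adj := by
        intro x
        rw [List.isChain_cons, List.isChain_append]
        refine ⟨?_, hn x, .singleton _, ?_⟩
        · simp [head_traversal, adj_conn_out _ (hc x)]
        · simp [getLast_traversal, (adj_conn_out _ (hc x)).symm]
      rw [traversal]
      simp [hT, e (.out_base _ _), e (.base_near _), e (.near_far _ _),
        e (.far_conn _ _), e .near_near]

end

/-! ### The Hamiltonian path -/

section

variable {ℓ : ℕ}

/-- The root of the tree `B_ℓ`. -/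
def Node.root (ℓ : ℕ) : Node ℓ := ⟨[], by have := three_le_treeDepth ℓ; simp; omega⟩

/-- The Hamiltonian path of `G_ℓ`, as a list. -/
def hamiltonList (ℓ : ℕ) : List (Node ℓ × GadgetVertex) := traversal (treeDepth ℓ) (Node.root ℓ)

theorem root_level (ℓ : ℕ) : (Node.root ℓ).1.length + treeDepth ℓ = treeDepth ℓ := by
  simp [Node.root]

/-- The traversal of a subtree is a contiguous part of the Hamiltonian path. -/
theorem traversal_infix (s : Node ℓ) {k : ℕ} (hs : s.1.length + k = treeDepth ℓ) :
    traversal k s <:+: hamiltonList ℓ := by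
  obtain ⟨l, hl⟩ := s
  induction l generalizing k with
  | nil =>
    obtain rfl : k = treeDepth ℓ := by simpa using hs
    exact List.infix_rfl
  | cons x l ih =>
    simp only [List.length_cons] at hs hl
    have h1 := ih (k := k + 1) (by omega) (by simp only; omega)
    refine List.IsInfix.trans ?_ h1
    have hc : Node.child x (⟨l, by omega⟩ : Node ℓ) = ⟨x :: l, hl⟩ := by simp [Node.child, hl]
    rw [← hc, traversal]
    cases x
    · exact ⟨_, _, by rw [List.append_assoc]⟩
    · exact ⟨_ ++ (_ ++ _), _, by simp only [List.append_assoc]; rfl⟩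

/-- The Hamiltonian path of `G_ℓ`. -/
def hamiltonPath (ℓ : ℕ) : Copy (pathGraph (hamiltonList ℓ).length) (ribbedTree ℓ) where
  toHom :=
    { toFun := fun i => (hamiltonList ℓ).get i
      map_rel' := by
        have hch := List.isChain_iff_getElem.1 (isChain_traversal (root_level ℓ))
        intro i j hij
        rw [pathGraph_adj] at hij
        rcases hij with h | h
        · have := hch i (by rw [h]; exact j.2)
          simp only [h] at this
          exact this
        · have := hch j (by rw [h]; exact i.2)
          simp only [h] at this
          exact this.symm }
  injective' := List.nodup_iff_injective_get.1 (nodup_traversal (root_level ℓ))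

theorem hamiltonPath_bijective (ℓ : ℕ) : Function.Bijective (hamiltonPath ℓ) := by
  refine ⟨(hamiltonPath ℓ).injective', fun v => ?_⟩
  have : v ∈ hamiltonList ℓ :=
    (mem_traversal (root_level ℓ) v).2 (List.nil_suffix (l := v.1.1))
  exact List.mem_iff_get.1 this

theorem length_hamiltonList (ℓ : ℕ) : (hamiltonList ℓ).length + 16 = 16 * 2 ^ treeDepth ℓ :=
  length_traversal _ _

theorem card_ribbedTree (ℓ : ℕ) : Nat.card (Node ℓ × GadgetVertex) = (hamiltonList ℓ).length := by
  rw [← Nat.card_congr (Equiv.ofBijective _ (hamiltonPath_bijective ℓ)), Nat.card_fin]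

theorem two_pow_le_length (h : 1 ≤ ℓ) : 2 ^ 2 ^ ℓ ≤ (hamiltonList ℓ).length := by
  have h1 := length_hamiltonList ℓ
  have h2 : 2 ^ ℓ ≤ treeDepth ℓ := by
    obtain ⟨k, rfl⟩ := Nat.exists_eq_add_of_le' h
    have := Nat.one_le_two_pow (n := k)
    simp only [treeDepth, Nat.add_sub_cancel, pow_succ]
    omega
  have h3 : 2 ^ 2 ^ ℓ ≤ 2 ^ treeDepth ℓ := Nat.pow_le_pow_right (by omega) h2
  have h4 : 2 ^ 1 ≤ 2 ^ treeDepth ℓ :=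
    Nat.pow_le_pow_right (by omega) (by have := three_le_treeDepth ℓ; omega)
  omega

/-- The position of a vertex on the Hamiltonian path. -/
noncomputable def pos (v : Node ℓ × GadgetVertex) : Fin (hamiltonList ℓ).length :=
  (Equiv.ofBijective _ (hamiltonPath_bijective ℓ)).symm v

@[simp] theorem hamiltonPath_pos (v : Node ℓ × GadgetVertex) : hamiltonPath ℓ (pos v) = v :=
  (Equiv.ofBijective _ (hamiltonPath_bijective ℓ)).apply_symm_apply v

@[simp] theorem pos_hamiltonPath (i : Fin (hamiltonList ℓ).length) : pos (hamiltonPath ℓ i) = i :=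
  (Equiv.ofBijective _ (hamiltonPath_bijective ℓ)).symm_apply_apply i

theorem eq_pos_iff {i : Fin (hamiltonList ℓ).length} {v : Node ℓ × GadgetVertex} :
    i = pos v ↔ hamiltonPath ℓ i = v := by
  constructor
  · rintro rfl; simp
  · rintro rfl; simp

theorem isChain_pos (s : Node ℓ) {k : ℕ} (hs : s.1.length + k = treeDepth ℓ) :
    (traversal k s).IsChain fun u v => (pos u).1 + 1 = (pos v).1 := by
  refine List.IsChain.infix ?_ (traversal_infix s hs)
  rw [List.isChain_iff_getElem]
  intro i hi
  have h1 : pos ((hamiltonList ℓ)[i]) = ⟨i, by omega⟩ := (eq_pos_iff.2 rfl).symm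
  have h2 : pos ((hamiltonList ℓ)[i + 1]) = ⟨i + 1, hi⟩ := (eq_pos_iff.2 rfl).symm
  rw [h1, h2]

theorem pairwise_pos (s : Node ℓ) {k : ℕ} (hs : s.1.length + k = treeDepth ℓ) :
    (traversal k s).Pairwise fun u v => pos u < pos v := by
  have : IsTrans (Node ℓ × GadgetVertex) fun u v => pos u < pos v := ⟨fun _ _ _ => lt_trans⟩
  rw [← List.isChain_iff_pairwise]
  exact (isChain_pos s hs).imp fun u v h => by rw [Fin.lt_def]; omega

/-- The edges of a gadget that lie on the Hamiltonian path, apart from those between connectors of a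
leaf. -/
theorem consecutive_gadget (s : Node ℓ) {R : Node ℓ × GadgetVertex → Node ℓ × GadgetVertex → Prop}
    (hR : R = fun u v => (pos u).1 + 1 = (pos v).1) :
    (∀ x, R (s, out x) (s, base x) ∨ R (s, base x) (s, out x)) ∧
    (∀ x, R (s, base x) (s, near x x) ∨ R (s, near x x) (s, base x)) ∧
    (∀ x y, R (s, near x y) (s, far x y) ∨ R (s, far x y) (s, near x y)) ∧
    (∀ x y, R (s, far x y) (s, conn x y) ∨ R (s, conn x y) (s, far x y)) ∧
    R (s, near false true) (s, near true false) := by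
  obtain ⟨k, hk⟩ : ∃ k, s.1.length + (k + 1) = treeDepth ℓ :=
    ⟨treeDepth ℓ - s.1.length - 1, by have := s.2; omega⟩
  have h := isChain_pos s hk
  rw [← hR, traversal, List.isChain_append, List.isChain_append, List.isChain_append,
    List.isChain_append] at h
  obtain ⟨h1, ⟨-, ⟨h2, ⟨-, h3, -⟩, -⟩, -⟩, -⟩ := h
  simp only [List.isChain_cons_cons, List.isChain_singleton, and_true] at h1 h2 h3
  simp only [Bool.forall_bool]
  tauto

/-- The tree edges lie on the Hamiltonian path. -/
theorem consecutive_tree {s t : Node ℓ} {x : Bool} (ht : t.1 = x :: s.1) :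
    (pos (s, conn x false)).1 + 1 = (pos (t, out false)).1 ∧
      (pos (t, out true)).1 + 1 = (pos (s, conn x true)).1 := by
  obtain ⟨k, hk⟩ : ∃ k, s.1.length + (k + 1 + 1) = treeDepth ℓ := by
    have := t.2
    rw [ht, List.length_cons] at this
    exact ⟨treeDepth ℓ - s.1.length - 2, by omega⟩
  have hc : ∀ x, (s.child x).1 = x :: s.1 := fun x => s.child_val (by omega)
  obtain rfl : s.child x = t := Subtype.ext ((hc x).trans ht.symm)
  have h := isChain_pos s hk
  rw [traversal, List.isChain_append, List.isChain_append, List.isChain_append,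
    List.isChain_append] at h
  obtain ⟨-, ⟨-, ⟨-, ⟨-, -, h1⟩, h2⟩, h3⟩, h4⟩ := h
  cases x
  · exact ⟨h4 _ (by simp) _ (by simp [traversal]),
      h3 _ (getLast_traversal k _) _ (by simp)⟩
  · exact ⟨h2 _ (by simp) _ (by simp [traversal]), h1 _ (getLast_traversal k _) _ (by simp)⟩

/-- The order of the Hamiltonian path in a subtree: it is enclosed by the out-ports of its root, and
the subtree of each child is enclosed by the two connectors on its side. -/
theorem pos_order (s : Node ℓ) :
    (∀ v, Below s v → pos (s, out false) ≤ pos v ∧ pos v ≤ pos (s, out true)) ∧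
    (∀ x v, (x :: s.1) <:+ v.1.1 → pos (s, conn x false) < pos v ∧ pos v < pos (s, conn x true)) ∧
    (∀ x, pos (s, conn x false) < pos (s, conn x true)) ∧
    pos (s, conn false true) < pos (s, conn true false) := by
  obtain ⟨k, hk⟩ : ∃ k, s.1.length + (k + 1) = treeDepth ℓ :=
    ⟨treeDepth ℓ - s.1.length - 1, by have := s.2; omega⟩
  have h := pairwise_pos s hk
  have hm := mem_traversal hk
  have hc := mem_traversal_child hk
  refine ⟨fun v hv => ⟨?_, ?_⟩, ?_⟩
  · have hv' := (hm v).2 hv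
    rw [traversal] at h hv'
    rcases List.mem_cons.1 hv' with rfl | hv'
    exacts [le_rfl, ((List.pairwise_cons.1 h).1 v hv').le]
  · have hv' := (hm v).2 hv
    obtain ⟨l, hl⟩ : ∃ l, traversal (k + 1) s = l ++ [(s, out true)] :=
      List.getLast?_eq_some_iff.1 (getLast_traversal k s)
    rw [hl] at h hv'
    rcases List.mem_append.1 hv' with hv' | hv'
    · exact ((List.pairwise_append.1 h).2.2 v hv' _ (by simp)).le
    · rw [List.mem_singleton.1 hv']
  · rw [traversal, List.pairwise_append, List.pairwise_append, List.pairwise_append,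
      List.pairwise_append] at h
    obtain ⟨-, ⟨-, ⟨h0, ⟨-, -, h1⟩, h2⟩, h3⟩, h4⟩ := h
    refine ⟨fun x v hv => ?_, fun x => ?_, ?_⟩
    · have hv' := (hc x v).2 hv
      cases x
      · exact ⟨h4 _ (by simp) _ (by simp [hv']), h3 _ hv' _ (by simp)⟩
      · exact ⟨h2 _ (by simp) _ (by simp [hv']), h1 _ hv' _ (by simp)⟩
    · cases x
      · exact h4 _ (by simp) _ (by simp)
      · exact h2 _ (by simp) _ (by simp)
    · simp only [List.pairwise_cons] at h0
      exact h0.1 _ (by simp)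

end

/-! ### The off-path graph is a constellation -/

section

variable {ℓ : ℕ} {s t : Node ℓ} {i j : Fin (hamiltonList ℓ).length}

/-- The graph `G_ℓ - E(P)` for the Hamiltonian path `P`, ordered along `P`. -/
abbrev offGraph (ℓ : ℕ) : SimpleGraph (Fin (hamiltonList ℓ).length) := offPath (hamiltonPath ℓ)

theorem offGraph_adj (h : (offGraph ℓ).Adj i j) {u : Node ℓ × GadgetVertex}
    (hi : hamiltonPath ℓ i = u) : ∃ w, hamiltonPath ℓ j = w ∧ (ribbedTree ℓ).Adj u w ∧
      ¬ ((pos u).1 + 1 = (pos w).1 ∨ (pos w).1 + 1 = (pos u).1) := by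
  obtain ⟨h1, h2⟩ := h
  rw [pathGraph_adj] at h2
  refine ⟨_, rfl, hi ▸ h1, ?_⟩
  rw [← hi]
  simpa using h2

theorem off_conn {x y : Bool} (h : (offGraph ℓ).Adj i j) (hi : hamiltonPath ℓ i = (s, conn x y)) :
    hamiltonPath ℓ j = (s, conn x !y) := by
  obtain ⟨w, hj, hadj, hoff⟩ := offGraph_adj h hi
  obtain ⟨-, -, -, h4, -⟩ := consecutive_gadget s rfl
  rcases adj_conn hadj with rfl | rfl | ⟨t, ht, rfl⟩
  · have := h4 x y; tauto
  · exact hj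
  · have := consecutive_tree ht
    cases y <;> tauto

theorem off_far {x y : Bool} (h : (offGraph ℓ).Adj i j) (hi : hamiltonPath ℓ i = (t, far x y)) :
    ∃ r : Node ℓ, r.IsAncestor t ∧ (r.depth, t.depth) ∈ nestedIntervals ℓ ∧
      hamiltonPath ℓ j = (r, out true) := by
  obtain ⟨w, hj, hadj, hoff⟩ := offGraph_adj h hi
  obtain ⟨-, -, h3, h4, -⟩ := consecutive_gadget t rfl
  rcases adj_far hadj with rfl | rfl | ⟨r, hr, hN, rfl⟩
  · have := h3 x y; tauto
  · have := h4 x y; tauto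
  · exact ⟨r, hr, hN, hj⟩

theorem off_near {x y : Bool} (h : (offGraph ℓ).Adj i j) (hi : hamiltonPath ℓ i = (t, near x y)) :
    ∃ r : Node ℓ, r.IsAncestor t ∧ (r.depth, t.depth) ∈ nestedIntervals ℓ ∧
      hamiltonPath ℓ j = (r, out false) := by
  obtain ⟨w, hj, hadj, hoff⟩ := offGraph_adj h hi
  obtain ⟨-, h2, h3, -, h5⟩ := consecutive_gadget t rfl
  rcases adj_near hadj with rfl | ⟨rfl, rfl⟩ | ⟨hxy, rfl⟩ | ⟨r, hr, hN, rfl⟩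
  · have := h3 x y; tauto
  · have := h2 x; tauto
  · cases x <;> cases y <;> simp_all
  · exact ⟨r, hr, hN, hj⟩

theorem off_base {x : Bool} (h : (offGraph ℓ).Adj i j) (hi : hamiltonPath ℓ i = (s, base x)) :
    hamiltonPath ℓ j = (s, out !x) := by
  obtain ⟨w, hj, hadj, hoff⟩ := offGraph_adj h hi
  obtain ⟨h1, h2, -⟩ := consecutive_gadget s rfl
  have h1 := h1 x
  have h2 := h2 x
  rcases adj_base hadj with rfl | rfl | rfl
  · cases x
    · tauto
    · exact hj
  · cases x
    · exact hj
    · tauto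
  · tauto

theorem off_out {y : Bool} (h : (offGraph ℓ).Adj i j) (hi : hamiltonPath ℓ i = (s, out y)) :
    hamiltonPath ℓ j = (s, base !y) ∨ ∃ r : Node ℓ, s.IsAncestor r ∧
      (s.depth, r.depth) ∈ nestedIntervals ℓ ∧ ∃ a b, hamiltonPath ℓ j = (r, inPort y a b) := by
  obtain ⟨w, hj, hadj, hoff⟩ := offGraph_adj h hi
  obtain ⟨h1, -⟩ := consecutive_gadget s rfl
  rcases adj_out hadj with ⟨x, rfl⟩ | ⟨u, x, hu, rfl⟩ | ⟨r, hr, hN, a, b, rfl⟩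
  · have := h1 y
    by_cases hxy : x = y
    · subst hxy; tauto
    · obtain rfl : x = !y := by cases x <;> cases y <;> simp_all
      exact .inl hj
  · have := consecutive_tree hu
    cases y <;> tauto
  · exact .inr ⟨r, hr, hN, a, b, hj⟩

/-- The off-path neighbors of an out-port have no other off-path neighbor. -/
theorem off_leaf {y : Bool} (h : (offGraph ℓ).Adj (pos (s, out y)) i) (hij : (offGraph ℓ).Adj i j) :
    j = pos (s, out y) := by
  rw [eq_pos_iff]
  rcases off_out h (hamiltonPath_pos _) with hi | ⟨t, ht, hN, a, b, hi⟩
  · simpa using off_base hij hi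
  · cases y
    · obtain ⟨r, hr, hN', hj⟩ := off_near hij hi
      rw [hj, rib_origin_unique hr ht hN' hN]
    · obtain ⟨r, hr, hN', hj⟩ := off_far hij hi
      rw [hj, rib_origin_unique hr ht hN' hN]

/-- The positions of the vertices at the nodes that extend `l`. -/
def subtreeSet (ℓ : ℕ) (l : List Bool) : Set (Fin (hamiltonList ℓ).length) :=
  {i | l <:+ (hamiltonPath ℓ i).1.1}

theorem mem_subtreeSet {l : List Bool} : i ∈ subtreeSet ℓ l ↔ l <:+ (hamiltonPath ℓ i).1.1 :=
  Iff.rfl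

/-- The two connectors of `s` on the side `x`, and the subtree of the child of `s` on this side. -/
def sideSet (s : Node ℓ) (x : Bool) : Set (Fin (hamiltonList ℓ).length) :=
  {pos (s, conn x false), pos (s, conn x true)} ∪ subtreeSet ℓ (x :: s.1)

theorem pos_inj {u v : Node ℓ × GadgetVertex} : pos u = pos v ↔ u = v := by
  rw [eq_pos_iff, hamiltonPath_pos]

theorem mem_sideSet {x : Bool} : i ∈ sideSet s x ↔ (∃ y, hamiltonPath ℓ i = (s, conn x y)) ∨
    (x :: s.1) <:+ (hamiltonPath ℓ i).1.1 := by
  simp [sideSet, mem_subtreeSet, eq_pos_iff]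

theorem isConstellationOn_sideSet {x : Bool}
    (h : IsConstellationOn (offGraph ℓ) (subtreeSet ℓ (x :: s.1))) :
    IsConstellationOn (offGraph ℓ) (sideSet s x) := by
  obtain ⟨-, h2, h3, -⟩ := pos_order s
  refine h.add_star (c := pos (s, conn x false)) (.inl (.inl rfl)) (.inl ?_)
    Set.subset_union_right ?_ ?_ ?_
  · rintro i ((rfl | rfl) | hi)
    · exact le_rfl
    · exact (h3 x).le
    · have := (h2 x _ hi).1.le
      rwa [pos_hamiltonPath] at this
  · rw [mem_subtreeSet, hamiltonPath_pos]
    exact not_cons_suffix _ _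
  · intro i hi hadj
    rw [mem_subtreeSet, off_conn hadj (hamiltonPath_pos _)] at hi
    exact not_cons_suffix _ _ hi
  · rintro i ((rfl | rfl) | hi) hiT hne j - hij
    · exact absurd rfl hne
    · rw [eq_pos_iff, off_conn hij (hamiltonPath_pos _)]; rfl
    · exact absurd hi hiT

theorem isConstellationOn_sides
    (h : ∀ x, IsConstellationOn (offGraph ℓ) (subtreeSet ℓ (x :: s.1))) :
    IsConstellationOn (offGraph ℓ) (sideSet s false ∪ sideSet s true) := by
  obtain ⟨-, h2, h3, h4⟩ := pos_order s
  refine .concat _ _ ?_ ?_ (isConstellationOn_sideSet (h _)) (isConstellationOn_sideSet (h _))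
  · have hle : ∀ i ∈ sideSet s false, i ≤ pos (s, conn false true) := by
      rintro i ((rfl | rfl) | hi)
      · exact (h3 _).le
      · exact le_rfl
      · have := (h2 _ _ hi).2.le
        rwa [pos_hamiltonPath] at this
    have hge : ∀ i ∈ sideSet s true, pos (s, conn true false) ≤ i := by
      rintro i ((rfl | rfl) | hi)
      · exact le_rfl
      · exact (h3 _).le
      · have := (h2 _ _ hi).1.le
        rwa [pos_hamiltonPath] at this
    exact fun i hi j hj => (hle i hi).trans_lt (h4.trans_le (hge j hj))
  · intro i hi j hj hij
    rw [mem_sideSet] at hi hj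
    rcases hi with ⟨y, hi⟩ | hi
    · rw [off_conn hij hi] at hj
      rcases hj with ⟨z, hj⟩ | hj
      · simp at hj
      · exact not_cons_suffix _ _ hj
    · have hl : s.1.length + 1 < treeDepth ℓ := by
        have := hi.length_le
        have := (hamiltonPath ℓ i).1.2
        simp only [List.length_cons] at *
        omega
      have hc := s.child_val (x := false) hl
      have hbi : Below (s.child false) (hamiltonPath ℓ i) := by rwa [Below, hc]
      have hbj : ¬ Below (s.child false) (hamiltonPath ℓ j) := by
        rw [Below, hc]
        intro h'
        rcases hj with ⟨y, hj⟩ | hj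
        · rw [hj] at h'; exact not_cons_suffix _ _ h'
        · simpa using cons_suffix_unique h' hj
      rcases boundary hbi hbj hij.1 with ⟨u, x, y, hu, -, h5⟩ | ⟨r, y, hr, -, h5⟩
      · obtain ⟨rfl, hu'⟩ := List.cons_eq_cons.1 (hc.symm.trans hu)
        rw [h5] at hj
        rcases hj with ⟨z, hj⟩ | hj
        · simp at hj
        · rw [← hu'] at hj; exact not_cons_suffix _ _ hj
      · rw [h5] at hj
        rcases hj with ⟨z, hj⟩ | hj
        · simp at hj
        · have := hr.length_lt
          have := hj.length_le
          simp only [hc, List.length_cons] at *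
          omega

/-- The subtree of `s` consists of the stars of the first and the last vertex, which are the
out-ports of `s`, of isolated vertices, and of a part of its two sides. -/
theorem isConstellationOn_subtreeSet
    (h : ∀ x, IsConstellationOn (offGraph ℓ) (subtreeSet ℓ (x :: s.1))) :
    IsConstellationOn (offGraph ℓ) (subtreeSet ℓ s.1) := by
  obtain ⟨h1, -⟩ := pos_order s
  set A := subtreeSet ℓ s.1 with hA
  set c₁ := pos (s, out false) with hc₁
  set c₂ := pos (s, out true) with hc₂
  -- `A'` remains after the removal of the star of the first vertex.
  set A' := {i ∈ A | i ≠ c₁ ∧ ¬ (offGraph ℓ).Adj c₁ i} with hA'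
  set X := sideSet s false ∪ sideSet s true with hX
  set T := {i ∈ X | i ∈ A' ∧ ¬ (offGraph ℓ).Adj c₂ i} with hT
  have hc₂A : c₂ ∈ A := by rw [hA, mem_subtreeSet, hamiltonPath_pos]
  have hc₁A : c₁ ∈ A := by rw [hA, mem_subtreeSet, hamiltonPath_pos]
  have hTc : IsConstellationOn (offGraph ℓ) T :=
    (isConstellationOn_sides h).subset fun i hi => hi.1
  have hA'c : IsConstellationOn (offGraph ℓ) A' := by
    refine hTc.add_star (c := c₂) ⟨hc₂A, ?_, ?_⟩ (.inr ?_) (fun i hi => hi.2.1) ?_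
      (fun i hi => hi.2.2) ?_
    · rw [hc₁, hc₂, Ne, pos_inj]; simp
    · intro hadj
      rcases off_out hadj (hamiltonPath_pos _) with h' | ⟨r, -, -, a, b, h'⟩ <;>
        simp [hc₂, inPort] at h'
    · intro i hi
      have := (h1 _ hi.1).2
      rwa [pos_hamiltonPath] at this
    · intro hT
      rcases hT.1 with h' | h' <;> rw [mem_sideSet, hamiltonPath_pos] at h' <;>
        rcases h' with ⟨y, h'⟩ | h'
      · simp at h'
      · exact not_cons_suffix _ _ h'
      · simp at h'
      · exact not_cons_suffix _ _ h'
    · rintro i hi hiT hne j hj hij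
      by_cases hadj : (offGraph ℓ).Adj c₂ i
      · exact off_leaf hadj hij
      have hiX : i ∉ X := fun hiX => hiT ⟨hiX, hi, hadj⟩
      rw [hX, Set.mem_union, mem_sideSet, mem_sideSet] at hiX
      push Not at hiX
      obtain ⟨⟨hi1, hi2⟩, hi3, hi4⟩ := hiX
      have hrib : ∀ {r : Node ℓ} {y : Bool}, r.IsAncestor s → hamiltonPath ℓ j = (r, out y) →
          False := by
        intro r y hr hjr
        have := mem_subtreeSet.1 hj.1
        rw [hjr] at this
        exact absurd this.length_le (not_le.2 hr.length_lt)
      have his : (hamiltonPath ℓ i).1 = s := by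
        rcases suffix_iff_eq_or_cons.1 (mem_subtreeSet.1 hi.1) with h' | ⟨_ | _, h'⟩
        exacts [Subtype.ext h', absurd h' hi2, absurd h' hi4]
      obtain ⟨g, hg⟩ : ∃ g, hamiltonPath ℓ i = (s, g) := ⟨_, Prod.ext his rfl⟩
      cases g with
      | out y =>
        cases y
        · exact absurd (eq_pos_iff.2 hg) hi.2.1
        · exact absurd (eq_pos_iff.2 hg) hne
      | base x =>
        have := off_base hij hg
        cases x
        · exact eq_pos_iff.2 this
        · exact absurd (eq_pos_iff.2 this) hj.2.1
      | near x y =>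
        obtain ⟨r, hr, -, hjr⟩ := off_near hij hg
        exact (hrib hr hjr).elim
      | far x y =>
        obtain ⟨r, hr, -, hjr⟩ := off_far hij hg
        exact (hrib hr hjr).elim
      | conn x y =>
        cases x
        · exact absurd hg (hi1 y)
        · exact absurd hg (hi3 y)
  refine hA'c.add_star (c := c₁) hc₁A (.inl ?_) (fun i hi => hi.1) (fun h => h.2.1 rfl)
    (fun i hi => hi.2.2) ?_
  · intro i hi
    have := (h1 _ hi).1
    rwa [pos_hamiltonPath] at this
  · intro i hi hiA' hne j _ hij
    by_cases hadj : (offGraph ℓ).Adj c₁ i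
    · exact off_leaf hadj hij
    · exact absurd ⟨hi, hne, hadj⟩ hiA'

theorem isConstellation_offGraph (ℓ : ℕ) : IsConstellation (offGraph ℓ) := by
  have key : ∀ (k : ℕ) (l : List Bool), l.length + k = treeDepth ℓ →
      IsConstellationOn (offGraph ℓ) (subtreeSet ℓ l) := by
    intro k
    induction k with
    | zero =>
      intro l hl
      have : subtreeSet ℓ l = ∅ := by
        refine Set.eq_empty_of_forall_notMem fun i hi => ?_
        have := (mem_subtreeSet.1 hi).length_le
        have := (hamiltonPath ℓ i).1.2
        omega
      rw [this]
      exact .empty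
    | succ k ih =>
      intro l hl
      exact isConstellationOn_subtreeSet (s := ⟨l, by omega⟩) fun x =>
        ih _ (by simp only [List.length_cons]; omega)
  have : subtreeSet ℓ [] = Set.univ := Set.eq_univ_of_forall fun i => List.nil_suffix
  rw [IsConstellation, ← this]
  exact key (treeDepth ℓ) [] (by simp)

end

/-! ### The function `g_H` -/

section

variable {ℓ : ℕ}

/-- A graph without edges is a constellation. -/
theorem isConstellation_bot {k : ℕ} : IsConstellation (⊥ : SimpleGraph (Fin k)) := by
  have := IsConstellationOn.empty.union_isolated (H := (⊥ : SimpleGraph (Fin k)))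
    (Set.toFinite Set.univ) (by simp)
  simpa [IsConstellation] using this

/-- The path of order `n` avoids `H`, which bounds the guaranteed orders. -/
theorem guaranteedOrders_isGreatest {k : ℕ} {H : SimpleGraph (Fin k)} (hH : ¬ IsConstellation H)
    (n : ℕ) : IsGreatest (guaranteedOrders H n) (inducedPathFunction H n) := by
  have hbdd : BddAbove (guaranteedOrders H n) := by
    refine ⟨n, fun m hm => ?_⟩
    have hoff : offPath (Copy.id (pathGraph n)) = ⊥ := by
      ext i j
      simp [offPath]
    have havoid : AvoidsPattern (Copy.id (pathGraph n)) H := fun hc =>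
      hH (IsConstellation.of_containsOrdered (hoff ▸ isConstellation_bot) hc)
    obtain ⟨q, hmq, ⟨e⟩⟩ := hm (Fin n) (pathGraph n) (Copy.id _) havoid
    exact hmq.trans (by simpa using Fintype.card_le_of_injective _ e.injective)
  refine ⟨Nat.sSup_mem ⟨0, fun V _ G P _ => ⟨0, le_rfl, ?_⟩⟩ hbdd, fun m hm => le_csSup hbdd hm⟩
  exact IsIndContained.of_isEmpty

/-- An initial segment of the Hamiltonian path of `G_ℓ` bounds `g_H(n)` for all `n` up to the order
of `G_ℓ`. -/
theorem inducedPathFunction_le (hℓ : 1 ≤ ℓ) {k n : ℕ} {H : SimpleGraph (Fin k)}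
    (hH : ¬ IsConstellation H) (hn : n ≤ 2 ^ 2 ^ ℓ) :
    inducedPathFunction H n ≤ 1000 * ℓ ^ 2 := by
  have hn' : n ≤ (hamiltonList ℓ).length := hn.trans (two_pow_le_length hℓ)
  let ι : Copy (pathGraph n) (pathGraph (hamiltonList ℓ).length) :=
    ⟨⟨Fin.castLE hn', fun {i j} h => by simpa [pathGraph_adj] using h⟩, Fin.castLE_injective hn'⟩
  have : Finite (Node ℓ × GadgetVertex) :=
    Finite.of_surjective _ (hamiltonPath_bijective ℓ).2
  have havoid : AvoidsPattern ((hamiltonPath ℓ).comp ι) H := by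
    rintro ⟨a, ha⟩
    refine hH ((isConstellation_offGraph ℓ).of_containsOrdered
      ⟨a.trans (Fin.castLEOrderEmb hn'), fun i j hij => ?_⟩)
    obtain ⟨h1, h2⟩ := ha i j hij
    refine ⟨h1, fun h => h2 ?_⟩
    simpa [pathGraph_adj] using h
  obtain ⟨q, hq, hind⟩ := (guaranteedOrders_isGreatest hH n).1 _ (ribbedTree ℓ)
    ((hamiltonPath ℓ).comp ι) havoid
  exact hq.trans (inducedPath_le hℓ hind)

theorem inducedPathFunction_isBigO {k : ℕ} {H : SimpleGraph (Fin k)} (hH : ¬ IsConstellation H) :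
    (fun n : ℕ => (inducedPathFunction H n : ℝ)) =O[Filter.atTop]
      (fun n : ℕ => (Real.logb 2 (Real.logb 2 (n : ℝ))) ^ 2) := by
  refine Asymptotics.IsBigO.of_bound 4000 ?_
  filter_upwards [Filter.eventually_ge_atTop 4] with n hn
  set x := Real.logb 2 (Real.logb 2 (n : ℝ)) with hx
  have hlog : 2 ≤ Real.logb 2 (n : ℝ) := by
    rw [Real.le_logb_iff_rpow_le (by norm_num) (by positivity)]
    norm_num
    exact_mod_cast hn
  have hx1 : 1 ≤ x := by
    rw [hx, Real.le_logb_iff_rpow_le (by norm_num) (by linarith)]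
    simpa using hlog
  -- This is the least `ℓ` with `n ≤ 2 ^ 2 ^ ℓ`.
  set ℓ := ⌈x⌉₊ with hℓ
  have hxℓ : x ≤ ℓ := Nat.le_ceil x
  have hℓx : (ℓ : ℝ) < x + 1 := Nat.ceil_lt_add_one (by linarith)
  have hℓ1 : 1 ≤ ℓ := by exact_mod_cast hx1.trans hxℓ
  have hnℓ : n ≤ 2 ^ 2 ^ ℓ := by
    have h1 : Real.logb 2 (n : ℝ) ≤ 2 ^ ℓ := by
      rw [← Real.rpow_natCast, ← Real.logb_le_iff_le_rpow (by norm_num) (by linarith)]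
      exact hxℓ
    rw [Real.logb_le_iff_le_rpow (by norm_num) (by positivity)] at h1
    have h2 : (n : ℝ) ≤ ((2 ^ 2 ^ ℓ : ℕ) : ℝ) := by
      push_cast
      rw [← Real.rpow_natCast 2 (2 ^ ℓ)]
      push_cast
      exact h1
    exact_mod_cast h2
  have hg : (inducedPathFunction H n : ℝ) ≤ 1000 * (ℓ : ℝ) ^ 2 := by
    exact_mod_cast inducedPathFunction_le hℓ1 hH hnℓ
  rw [Real.norm_of_nonneg (by positivity), Real.norm_of_nonneg (by positivity)]
  nlinarith

end

end OrderedPattern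

open OrderedPattern
theorem mainTheorem3 :
    (∀ (k : ℕ) (H : SimpleGraph (Fin k)), ¬ IsConstellation H →
      (∀ n : ℕ, IsGreatest (guaranteedOrders H n) (inducedPathFunction H n)) ∧
      (fun n : ℕ => (inducedPathFunction H n : ℝ)) =O[Filter.atTop]
        (fun n : ℕ => (Real.logb 2 (Real.logb 2 (n : ℝ))) ^ 2)) ∧
    (∃ C : ℕ, ∀ ℓ : ℕ, 1 ≤ ℓ →
      2 ^ 2 ^ ℓ ≤ Nat.card (Node ℓ × GadgetVertex) ∧
      IsDegenerate 2 (ribbedTree ℓ) ∧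
      (∀ q : ℕ, SimpleGraph.IsIndContained (SimpleGraph.pathGraph q) (ribbedTree ℓ) → q ≤ C * ℓ ^ 2) ∧
      ∃ (n : ℕ) (P : SimpleGraph.Copy (SimpleGraph.pathGraph n) (ribbedTree ℓ)),
        Function.Bijective P ∧
        IsConstellation (offPath P) ∧
        ∀ (k : ℕ) (H : SimpleGraph (Fin k)), ¬ IsConstellation H → AvoidsPattern P H) := by
  refine ⟨fun k H hH => ⟨guaranteedOrders_isGreatest hH, inducedPathFunction_isBigO hH⟩,
    1000, fun ℓ hℓ => ⟨?_, isDegenerate_ribbedTree ℓ, fun q hq => inducedPath_le hℓ hq,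
      (hamiltonList ℓ).length, hamiltonPath ℓ, hamiltonPath_bijective ℓ,
      isConstellation_offGraph ℓ,
      fun k H hH hc => hH ((isConstellation_offGraph ℓ).of_containsOrdered hc)⟩⟩
  rw [card_ribbedTree]
  exact two_pow_le_length hℓ
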